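/- **The calculus.** Fix countable sets of variables $f,x$, datatype names $D$, constructors $C$ and hole names $h$. * Types $T ::= T_1\to T_2 \mid () \mid (T_1,T_2)\mid D$. * Expressions $e ::= \mathsf{fix}\,f\,(\lambda x.e)\mid e_1\,e_2\mid x\mid ()\mid (e_1,e_2)\mid \mathsf{prj}_i\,e\mid C\,e\mid \mathsf{case}\ e\ \mathsf{of}\ \{C_j\,x_j\to e_j\}_j\mid {??}_h$ ($i\in\{1,2\}$). * Results $r ::= [E]\,\mathsf{fix}\,f\,(\lambda x.e)\mid ()\mid(r_1,r_2)\mid C\,r\mid[E]{??}_h\mid r_1\,r_2\mid\mathsf{prj}_i\,r\mid[E]\,\mathsf{case}\ r\ \mathsf{of}\ \{C_j\,x_j\to e_j\}_j\mid C^{-1}r$. Environments $E$ are finite lists of bindings $x\mapsto r$, type contexts $\Gamma$ finite lists of bindings $x:T$; later bindings shadow earlier ones. * Simple values $v::=()\mid(v_1,v_2)\mid C\,v$; examples $ex::=()\mid(ex_1,ex_2)\mid C\,ex\mid v\to ex\mid\top$. A world is a pair $(E,ex)$, and $X$ ranges over finite sets of worlds. * Hole fillings $F$ (holes to expressions), unfilled-hole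 constraints $U$ (holes to sets $X$) and hole contexts $\Delta$ (holes to contextual types $\Gamma\vdash T$) are finite maps. Constraints are pairs $K=(F;U)$. * $\Sigma$ is a finite list of datatypes, each with its list of constructors $C:T\to D$; datatypes are declared once, and every constructor belongs to one datatype, once. **Typing** (relative to $\Sigma;\Delta$). $\Gamma\vdash e:T$ is the usual simply typed system; ${??}_h$ has type $T$ in exactly the context $\Gamma$ with $\Delta(h)=(\Gamma\vdash T)$, and a $\mathsf{case}$ on $D$ has exactly one branch for each constructor of $D$, in the order of $\Sigma$. $\vdash r:T$ and $\vdash E:\Gamma$ type results and environments in the same way: $\vdash[E]{??}_h:T$ if $\Delta(h)=(\Gamma\vdash T)$ and $\vdash E:\Gamma$; the code of other closures is typed in a context that types its environment; $C^{-1}r$ has no type. Examples: $v\to ex:T_1\to T_2$ if $v:T_1$ and $ex:T_2$; $\top:T$ for every $T$; the other forms as expected. $U$ is *well typed under $\Delta$* if for every $U(h)=X$ there is $\Delta(h)=(\Gamma\vdash T)$ with $\vdash E:\Gamma$ and $\vdash ex:T$ for all $(E,ex)\in X$. $F$ is *well typed under $\Delta$* if for every $F(h)=e$ there is $\Delta(h)=(\Gamma\vdash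 T)$ with $\Gamma\vdash e:T$. **Evaluation** $E\vdash e\Rightarrow r$ is big-step call-by-value environment evaluation that does not stop at holes: ${??}_h$ evaluates to $[E]{??}_h$, functions to closures, and an application, projection or case whose head does not evaluate to a function closure, a pair, or a constructor among its branches yields the corresponding indeterminate result. **Resumption** $F\vdash r\Rightarrow r'$. If $F(h)=e\neq{??}_h$, then $[E]{??}_h$ is resumed by evaluating $e$ in $E$ and resuming the result; if $h\notin\mathrm{dom}\,F$ or $F(h)={??}_h$, then $[E]{??}_h$ becomes $[E']{??}_h$ with $F\vdash E\Rightarrow E'$ (pointwise). Resumption goes through closures (resuming the environment), pairs and constructors. For $r_1\,r_2$, $\mathsf{prj}_i\,r$, $[E]\mathsf{case}\,r\ldots$ and $C^{-1}r$ the parts are resumed first. An application whose function becomes a closure evaluates the body in the closure's environment extended by the closure and the argument, and resumes the result. A projection of a pair yields its component. A case whose scrutinee becomes $C_j\,r'$ evaluates $e_j$ in $E',x_j\mapsto r''$ with $F\vdash E\Rightarrow E'$, $F\vdash r'\Rightarrow r''$, and resumes the result. $C^{-1}r$ yields $r'$ if $F\vdash r\Rightarrow C\,r'$. If the head is still indeterminate,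 the indeterminate form is kept with its resumed parts. *Live evaluation* $E;F\vdash e\Rightarrow r$ means $E\vdash e\Rightarrow r_0$ and $F\vdash r_0\Rightarrow r$ for some $r_0$. **Satisfaction.** $F\vdash r\models\top$ always; $F\vdash()\models()$; pairs and constructors componentwise; $F\vdash r\models v\to ex$ iff $F\vdash r\,v\Rightarrow r'$ and $F\vdash r'\models ex$ for some $r'$. $F\vdash e\models X$ iff for all $(E,ex)\in X$ there is $r$ with $E;F\vdash e\Rightarrow r$ and $F\vdash r\models ex$. Finally $F'\models(F;U)$ iff $F'\supseteq F$ and $F'\vdash{??}_h\models U(h)$ for every $h\in\mathrm{dom}\,U$. **Syntactic merging.** $F_1\oplus F_2=F_1\cup F_2$ if they agree on common holes (undefined otherwise); $U_1\oplus U_2$ takes the union of the sets of worlds on common holes; $(F_1;U_1)\oplus(F_2;U_2)=(F_1\oplus F_2;\,U_1\oplus U_2)$. The empty merge is the empty constraint $(\emptyset;\emptyset)$. **Unevaluation and checking.** Let $\mathrm{Guesses}(\Delta,\Sigma,r)$ be an arbitrary non-deterministic function returning hole fillings that are well typed under $\Delta$. $F\vdash r\Leftarrow ex\dashv K$ (relative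 to $\Sigma;\Delta$) is generated by: $r\Leftarrow\top\dashv\emptyset$; $()\Leftarrow()\dashv\emptyset$; pairs componentwise with merge; $C\,r\Leftarrow C\,ex$ as $r\Leftarrow ex$; $[E]\mathsf{fix}\,f(\lambda x.e)\Leftarrow v\to ex\dashv K$ if $e$ checks against the world $((E,f\mapsto[E]\mathsf{fix}\,f(\lambda x.e),x\mapsto v),ex)$ with $K$; $[E]{??}_h\Leftarrow ex\dashv(\emptyset;h\mapsto\{(E,ex)\})$; $r_1\,r_2\Leftarrow ex$ as $r_1\Leftarrow v_2\to ex$ if $r_2$ is the simple value $v_2$; $\mathsf{prj}_1r\Leftarrow ex$ as $r\Leftarrow(ex,\top)$, and $\mathsf{prj}_2r\Leftarrow ex$ as $r\Leftarrow(\top,ex)$; $C^{-1}r\Leftarrow ex$ as $r\Leftarrow C\,ex$; $[E]\mathsf{case}\,r\,\mathsf{of}\{C_jx_j\to e_j\}\Leftarrow ex\dashv K_1\oplus K_2$ if, for some $j$, $r\Leftarrow C_j\top\dashv K_1$ and $e_j$ checks against $((E,x_j\mapsto C_j^{-1}r),ex)$ with $K_2$; and the same case result $\Leftarrow ex\dashv(F_g;\emptyset)\oplus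 K$ if $F_g\in\mathrm{Guesses}(\Delta,\Sigma,r)$, $F\oplus F_g\vdash r\Rightarrow C_j\,r'$, and $e_j$ checks under $F\oplus F_g$ against $((E,x_j\mapsto r'),ex)$ with $K$. Here $e$ *checks* under $F$ against $(E,ex)$ with $K$ if $E;F\vdash e\Rightarrow r$ and $F\vdash r\Leftarrow ex\dashv K$ for some $r$; $F\vdash e\rightleftharpoons X\dashv K$ means that $e$ checks against each world of $X$ and $K$ is the merge of the resulting constraints. **Semantic merging.** $\mathrm{Step}(F;U)=(F;\emptyset)\oplus\bigoplus_{h\in\mathrm{dom}\,U}K_h$, where $F\vdash F(h)\rightleftharpoons U(h)\dashv K_h$ if $h\in\mathrm{dom}\,F$, and $K_h=(\emptyset;h\mapsto U(h))$ otherwise. $\mathrm{Merge}(K)=K'$ if iterating the (non-deterministic) $\mathrm{Step}$ from $K$ until a step leaves the constraints unchanged ends in $K'$. **Hole synthesis.** $\Gamma\vdash T\rightsquigarrow e$ (guessing) generates exactly the hole-free expressions of type $T$ in $\Gamma$. $\mathrm{Filter}(X)$ removes the worlds whose example is $\top$. Fresh holes are distinct holes outside $\mathrm{dom}\,\Delta$.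 $\mathrm{Fill}$, for a goal $h:(\Gamma\vdash T)\models X$ under $\Sigma;\Delta;F$, returns $(K;\Delta')$ in four ways: * *Guess-and-check*: if $\Gamma\vdash T\rightsquigarrow e$ and $F[h\mapsto e]\vdash e\rightleftharpoons X\dashv K$, return $((h\mapsto e;\emptyset)\oplus K;\ \emptyset)$. * *Defer*: if $X\ne\emptyset$ and all its examples are $\top$, return $((h\mapsto{??}_h;\emptyset);\ \emptyset)$. * *Refine*: return $((h\mapsto e;U_G);\ \Delta_G)$, where the expression $e$ and the goals $G$ are determined by $T$ and the shape of $\mathrm{Filter}(X)$. If $T=()$ and all filtered examples are $()$: $e=()$ and no goals. If $T=(T_1,T_2)$ and the filtered worlds are $(E_j,(ex_j,ex_j'))$: $e=({??}_{h_1},{??}_{h_2})$ with goals $h_1:(\Gamma\vdash T_1)\models\{(E_j,ex_j)\}$ and $h_2:(\Gamma\vdash T_2)\models\{(E_j,ex'_j)\}$. If $T=D$, $C:T_1\to D$, and they are $(E_j,C\,ex_j)$: $e=C\,{??}_{h_1}$ with $h_1:(\Gamma\vdash T_1)\models\{(E_j,ex_j)\}$. If $T=T_1\to T_2$ and they are $(E_j,v_j\to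 ex_j)$: $e=\mathsf{fix}\,f(\lambda x.{??}_{h_1})$ with $h_1:(\Gamma,f:T_1\to T_2,x:T_1\vdash T_2)\models\{((E_j,f\mapsto[E_j]e,x\mapsto v_j),ex_j)\}$. All $h_i$ are fresh. * *Branch*: guess a scrutinee $e$ with $\Gamma\vdash D\rightsquigarrow e$; for each filtered world $(E_j,ex_j)$ choose a constructor $C_j$ of $D$ and let $E_j\vdash e\Rightarrow r_j$ and $F\vdash e\rightleftharpoons\{(E_j,C_j\top)\}\dashv K_j$. Return $((h\mapsto\mathsf{case}\,e\,\mathsf{of}\{C\,x_C\to{??}_{h_C}\}_C;\,U_G)\oplus\bigoplus_jK_j;\ \Delta_G)$ with one fresh hole $h_C$ for each constructor $C:T_C\to D$ and goals $h_C:(\Gamma,x_C:T_C\vdash T)\models\{((E_j,x_C\mapsto r'_j),ex_j): C_j=C\}$, where $r'_j=r''$ if $r_j=C\,r''$ and $r'_j=C^{-1}r_j$ otherwise. Here $U_G$ and $\Delta_G$ map each goal's hole to its worlds and to its contextual type. **Solve.** $\mathrm{Solve}_\Delta(F;\emptyset)$ returns $(F;\Delta)$. If $h\in\mathrm{dom}\,U$,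 $\Delta(h)=(\Gamma\vdash T)$, $\mathrm{Fill}$ for $h:(\Gamma\vdash T)\models U(h)$ under $\Delta;F$ returns $(K;\Delta_1)$, and $\mathrm{Merge}((F;U\setminus h)\oplus K)=K'$ relative to $\Delta\cup\Delta_1$, then $\mathrm{Solve}_\Delta(F;U)$ may return anything that $\mathrm{Solve}_{\Delta\cup\Delta_1}(K')$ returns. **Totality assumption.** We say that *evaluation and resumption are total for $(F',U)$ under $\Delta'$* if there is a set $P$ of expressions, closed under subexpressions, that contains every $F'(h)$ and all code stored in the closures of the environments of worlds in $U$, such that, for results and environments all of whose stored code lies in $P$: every $e\in P$ with $\Gamma\vdash e:T$ evaluates in every environment $E$ with $\vdash E:\Gamma$, and every well-typed result resumes under $F'$ (typing under $\Sigma;\Delta'$). **Theorem (Soundness of Solve).** Let $U$ and $F$ be well typed under $\Delta$, and suppose that $\mathrm{Solve}_\Delta(F;U)$ returns $(F';\Delta')$. Then $F'$ is well typed under $\Delta'$. Moreover, if evaluation and resumption are total for $(F',U)$ under $\Delta'$, then $F'\models(F;U)$. -/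

import Mathlib

noncomputable section

namespace Smyth

/-! ## Syntax -/

/-- Variables `f`, `x`. -/
abbrev Var := ℕ
/-- Datatype names `D`. -/
abbrev DName := ℕ
/-- Constructor names `C`. -/
abbrev Ctor := ℕ
/-- Hole names `h`. -/
abbrev Hole := ℕ

/-- Which component of a pair is projected. -/
inductive Side where
  | fst
  | snd

/-- The component of a pair selected by a projection. -/
def Side.pick {α : Type} : Side → α → α → α
  | .fst, a, _ => a
  | .snd, _, b => b

/-- Types `T ::= T₁ → T₂ | () | (T₁, T₂) | D`. -/
inductive Ty where
  | arrow (T₁ T₂ : Ty)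
  | unit
  | pair (T₁ T₂ : Ty)
  | data (D : DName)

/-- Expressions (sketches). `fix f x e` is the recursive function named `f` with argument `x` and
body `e`; `caseOf e arms` has the branches `C x → e'`, listed as triples `(C, x, e')`; `hole h` is
the hole named `h`. -/
inductive Exp where
  | fix (f x : Var) (e : Exp)
  | app (e₁ e₂ : Exp)
  | var (x : Var)
  | unit
  | pair (e₁ e₂ : Exp)
  | prj (i : Side) (e : Exp)
  | ctor (C : Ctor) (e : Exp)
  | caseOf (e : Exp) (arms : List (Ctor × Var × Exp))
  | hole (h : Hole)

/-- Results. The first four forms are determinate; `hole`, `app`, `prj` and `caseOf` are the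
indeterminate forms, and `unwrap C r` is the inverse constructor application `C⁻¹ r`. The lists of
pairs `(x, r)` in `fix`, `hole` and `caseOf` are the environments of the closures. -/
inductive Result where
  | fix (E : List (Var × Result)) (f x : Var) (e : Exp)
  | unit
  | pair (r₁ r₂ : Result)
  | ctor (C : Ctor) (r : Result)
  | hole (E : List (Var × Result)) (h : Hole)
  | app (r₁ r₂ : Result)
  | prj (i : Side) (r : Result)
  | caseOf (E : List (Var × Result)) (r : Result) (arms : List (Ctor × Var × Exp))
  | unwrap (C : Ctor) (r : Result)

/-- Environments `E`; the most recent binding is at the head of the list, and it shadows earlier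
bindings of the same variable (`List.lookup` returns the first match). -/
abbrev Env := List (Var × Result)

/-- Type contexts `Γ`, with the same conventions as environments. -/
abbrev Ctx := List (Var × Ty)

/-- Datatype contexts: each datatype with its constructors and their argument types. -/
abbrev DataCtx := List (DName × List (Ctor × Ty))

/-- Datatypes are declared once, and a constructor belongs to one datatype, once. -/
def DataCtx.WellFormed (Sg : DataCtx) : Prop :=
  (Sg.map Prod.fst).Nodup ∧ (Sg.flatMap fun d => d.2.map Prod.fst).Nodup

/-- `C : T → D` is declared. -/
def DataCtx.HasCtor (Sg : DataCtx) (C : Ctor) (T : Ty) (D : DName) : Prop :=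
  ∃ cs, (D, cs) ∈ Sg ∧ (C, T) ∈ cs

/-- Hole fillings `F`. -/
abbrev Filling := Finmap (fun _ : Hole => Exp)

/-- Hole type contexts `Δ`: finite maps from holes to contextual types `Γ ⊢ T`. -/
abbrev HoleCtx := Finmap (fun _ : Hole => Ctx × Ty)

/-- Simple values `v`. -/
inductive Val where
  | unit
  | pair (v₁ v₂ : Val)
  | ctor (C : Ctor) (v : Val)

/-- Examples; `io v ex` is the input-output example `v → ex` and `top` imposes no constraint. -/
inductive Ex where
  | unit
  | pair (ex₁ ex₂ : Ex)
  | ctor (C : Ctor) (ex : Ex)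
  | io (v : Val) (ex : Ex)
  | top

/-- A single example constraint (world) `(E, ex)`. -/
abbrev World := Env × Ex

instance : DecidableEq World := Classical.decEq _

/-- Example constraints `X`: finite sets of worlds. -/
abbrev Worlds := Finset World

/-- Unfilled-hole constraints `U`: finite maps from holes to example constraints. -/
abbrev Unfilled := Finmap (fun _ : Hole => Worlds)

/-- Unevaluation constraints `K = (F; U)`. -/
structure Constraints where
  F : Filling
  U : Unfilled

/-- The empty constraints. -/
def Constraints.empty : Constraints := ⟨∅, ∅⟩

/-- A synthesis goal `h : (Γ ⊢ T) ⊨ X`. -/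
structure Goal where
  h : Hole
  Γ : Ctx
  T : Ty
  X : Worlds

/-- Upcast of a simple value to a result. -/
def Val.toResult : Val → Result
  | .unit => .unit
  | .pair v₁ v₂ => .pair v₁.toResult v₂.toResult
  | .ctor C v => .ctor C v.toResult

/-- Downcast of a result to a simple value. -/
inductive Downcast : Result → Val → Prop
  | unit : Downcast .unit .unit
  | pair {r₁ r₂ v₁ v₂} :
      Downcast r₁ v₁ → Downcast r₂ v₂ → Downcast (.pair r₁ r₂) (.pair v₁ v₂)
  | ctor {C r v} : Downcast r v → Downcast (.ctor C r) (.ctor C v)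

/-! ## Type checking -/

/-- Expression typing `Σ; Δ; Γ ⊢ e : T`. -/
inductive HasType (Sg : DataCtx) (Δ : HoleCtx) : Ctx → Exp → Ty → Prop
  | fix {Γ f x e T₁ T₂} :
      HasType Sg Δ ((x, T₁) :: (f, .arrow T₁ T₂) :: Γ) e T₂ →
      HasType Sg Δ Γ (.fix f x e) (.arrow T₁ T₂)
  | var {Γ x T} : List.lookup x Γ = some T → HasType Sg Δ Γ (.var x) T
  | hole {Γ h T} : Δ.lookup h = some (Γ, T) → HasType Sg Δ Γ (.hole h) T
  | unit {Γ} : HasType Sg Δ Γ .unit .unit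
  | pair {Γ e₁ e₂ T₁ T₂} :
      HasType Sg Δ Γ e₁ T₁ → HasType Sg Δ Γ e₂ T₂ → HasType Sg Δ Γ (.pair e₁ e₂) (.pair T₁ T₂)
  | ctor {Γ C e T D} :
      Sg.HasCtor C T D → HasType Sg Δ Γ e T → HasType Sg Δ Γ (.ctor C e) (.data D)
  | app {Γ e₁ e₂ T₂ T} :
      HasType Sg Δ Γ e₁ (.arrow T₂ T) → HasType Sg Δ Γ e₂ T₂ → HasType Sg Δ Γ (.app e₁ e₂) T
  | prj {Γ i e T₁ T₂} :
      HasType Sg Δ Γ e (.pair T₁ T₂) → HasType Sg Δ Γ (.prj i e) (i.pick T₁ T₂)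
  | caseOf {Γ e arms D cs T} :
      HasType Sg Δ Γ e (.data D) → (D, cs) ∈ Sg →
      arms.map Prod.fst = cs.map Prod.fst →
      (∀ C T' x e', (C, T') ∈ cs → (C, x, e') ∈ arms → HasType Sg Δ ((x, T') :: Γ) e' T) →
      HasType Sg Δ Γ (.caseOf e arms) T

mutual

/-- Result typing `Σ; Δ ⊢ r : T`. There is no rule for inverse constructor applications, which are
internal to unevaluation. -/
inductive ResultTyped (Sg : DataCtx) (Δ : HoleCtx) : Result → Ty → Prop
  | fix {Γ E f x e T} :
      EnvTyped Sg Δ E Γ → HasType Sg Δ Γ (.fix f x e) T → ResultTyped Sg Δ (.fix E f x e) T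
  | hole {Γ E h T} :
      Δ.lookup h = some (Γ, T) → EnvTyped Sg Δ E Γ → ResultTyped Sg Δ (.hole E h) T
  | unit : ResultTyped Sg Δ .unit .unit
  | pair {r₁ r₂ T₁ T₂} :
      ResultTyped Sg Δ r₁ T₁ → ResultTyped Sg Δ r₂ T₂ →
      ResultTyped Sg Δ (.pair r₁ r₂) (.pair T₁ T₂)
  | ctor {C r T D} :
      Sg.HasCtor C T D → ResultTyped Sg Δ r T → ResultTyped Sg Δ (.ctor C r) (.data D)
  | app {r₁ r₂ T₂ T} :
      ResultTyped Sg Δ r₁ (.arrow T₂ T) → ResultTyped Sg Δ r₂ T₂ →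
      ResultTyped Sg Δ (.app r₁ r₂) T
  | prj {i r T₁ T₂} :
      ResultTyped Sg Δ r (.pair T₁ T₂) → ResultTyped Sg Δ (.prj i r) (i.pick T₁ T₂)
  | caseOf {Γ E r arms D cs T} :
      ResultTyped Sg Δ r (.data D) → (D, cs) ∈ Sg → EnvTyped Sg Δ E Γ →
      arms.map Prod.fst = cs.map Prod.fst →
      (∀ C T' x e', (C, T') ∈ cs → (C, x, e') ∈ arms → HasType Sg Δ ((x, T') :: Γ) e' T) →
      ResultTyped Sg Δ (.caseOf E r arms) T

/-- Environment typing `Σ; Δ ⊢ E : Γ`. -/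
inductive EnvTyped (Sg : DataCtx) (Δ : HoleCtx) : Env → Ctx → Prop
  | nil : EnvTyped Sg Δ [] []
  | cons {E Γ x r T} :
      EnvTyped Sg Δ E Γ → ResultTyped Sg Δ r T → EnvTyped Sg Δ ((x, r) :: E) ((x, T) :: Γ)

end

/-- Example typing `Σ; Δ ⊢ ex : T`. -/
inductive ExTyped (Sg : DataCtx) (Δ : HoleCtx) : Ex → Ty → Prop
  | unit : ExTyped Sg Δ .unit .unit
  | pair {ex₁ ex₂ T₁ T₂} :
      ExTyped Sg Δ ex₁ T₁ → ExTyped Sg Δ ex₂ T₂ → ExTyped Sg Δ (.pair ex₁ ex₂) (.pair T₁ T₂)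
  | ctor {C ex T D} :
      Sg.HasCtor C T D → ExTyped Sg Δ ex T → ExTyped Sg Δ (.ctor C ex) (.data D)
  | io {v ex T₁ T₂} :
      ResultTyped Sg Δ v.toResult T₁ → ExTyped Sg Δ ex T₂ →
      ExTyped Sg Δ (.io v ex) (.arrow T₁ T₂)
  | top {T} : ExTyped Sg Δ .top T

/-- Example constraints are well typed at the contextual type `Γ ⊢ T`. -/
def WorldsTyped (Sg : DataCtx) (Δ : HoleCtx) (X : Worlds) (Γ : Ctx) (T : Ty) : Prop :=
  ∀ w ∈ X, EnvTyped Sg Δ w.1 Γ ∧ ExTyped Sg Δ w.2 T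

/-- `U` is well typed under `Δ`. -/
def UnfilledTyped (Sg : DataCtx) (Δ : HoleCtx) (U : Unfilled) : Prop :=
  ∀ h X, U.lookup h = some X →
    ∃ Γ T, Δ.lookup h = some (Γ, T) ∧ WorldsTyped Sg Δ X Γ T

/-- `F` is well typed under `Δ`. -/
def FillingTyped (Sg : DataCtx) (Δ : HoleCtx) (F : Filling) : Prop :=
  ∀ h e, F.lookup h = some e → ∃ Γ T, Δ.lookup h = some (Γ, T) ∧ HasType Sg Δ Γ e T

/-! ## Live evaluation -/

/-- Expression evaluation `E ⊢ e ⇒ r`. -/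
inductive Eval : Env → Exp → Result → Prop
  | fix {E f x e} : Eval E (.fix f x e) (.fix E f x e)
  | var {E x r} : List.lookup x E = some r → Eval E (.var x) r
  | hole {E h} : Eval E (.hole h) (.hole E h)
  | unit {E} : Eval E .unit .unit
  | pair {E e₁ e₂ r₁ r₂} : Eval E e₁ r₁ → Eval E e₂ r₂ → Eval E (.pair e₁ e₂) (.pair r₁ r₂)
  | ctor {E C e r} : Eval E e r → Eval E (.ctor C e) (.ctor C r)
  | app {E e₁ e₂ E_f f x e_f r₂ r} :
      Eval E e₁ (.fix E_f f x e_f) → Eval E e₂ r₂ →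
      Eval ((x, r₂) :: (f, .fix E_f f x e_f) :: E_f) e_f r →
      Eval E (.app e₁ e₂) r
  | appIndet {E e₁ e₂ r₁ r₂} :
      Eval E e₁ r₁ → Eval E e₂ r₂ → (∀ E_f f x e_f, r₁ ≠ .fix E_f f x e_f) →
      Eval E (.app e₁ e₂) (.app r₁ r₂)
  | prj {E i e r₁ r₂} : Eval E e (.pair r₁ r₂) → Eval E (.prj i e) (i.pick r₁ r₂)
  | prjIndet {E i e r} :
      Eval E e r → (∀ r₁ r₂, r ≠ .pair r₁ r₂) → Eval E (.prj i e) (.prj i r)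
  | caseOf {E e arms C x e' r r'} :
      (C, x, e') ∈ arms → Eval E e (.ctor C r) → Eval ((x, r) :: E) e' r' →
      Eval E (.caseOf e arms) r'
  | caseIndet {E e arms r} :
      Eval E e r → (∀ C x e' r', (C, x, e') ∈ arms → r ≠ .ctor C r') →
      Eval E (.caseOf e arms) (.caseOf E r arms)

mutual

/-- Resumption `F ⊢ r ⇒ r'`. In the rule `caseOf`, applying the non-recursive closure
`[E] λx. e` of the selected branch to `r'` is spelled out: the closure environment and the argument
are resumed, the branch is evaluated, and its result is resumed. -/
inductive Resume (F : Filling) : Result → Result → Prop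
  | holeResume {E h e r r'} :
      F.lookup h = some e → e ≠ .hole h → Eval E e r → Resume F r r' → Resume F (.hole E h) r'
  | holeIndet {E E' h} :
      (F.lookup h = none ∨ F.lookup h = some (.hole h)) → ResumeEnv F E E' →
      Resume F (.hole E h) (.hole E' h)
  | fix {E E' f x e} : ResumeEnv F E E' → Resume F (.fix E f x e) (.fix E' f x e)
  | unit : Resume F .unit .unit
  | pair {r₁ r₂ r₁' r₂'} :
      Resume F r₁ r₁' → Resume F r₂ r₂' → Resume F (.pair r₁ r₂) (.pair r₁' r₂')
  | ctor {C r r'} : Resume F r r' → Resume F (.ctor C r) (.ctor C r')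
  | app {r₁ r₂ r₂' E_f f x e_f r r'} :
      Resume F r₁ (.fix E_f f x e_f) → Resume F r₂ r₂' →
      Eval ((x, r₂') :: (f, .fix E_f f x e_f) :: E_f) e_f r → Resume F r r' →
      Resume F (.app r₁ r₂) r'
  | appIndet {r₁ r₂ r₁' r₂'} :
      Resume F r₁ r₁' → Resume F r₂ r₂' → (∀ E_f f x e_f, r₁' ≠ .fix E_f f x e_f) →
      Resume F (.app r₁ r₂) (.app r₁' r₂')
  | prj {i r r₁ r₂} : Resume F r (.pair r₁ r₂) → Resume F (.prj i r) (i.pick r₁ r₂)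
  | prjIndet {i r r'} :
      Resume F r r' → (∀ r₁ r₂, r' ≠ .pair r₁ r₂) → Resume F (.prj i r) (.prj i r')
  | caseOf {E E' r arms C x e r' r'' r₀ r₁} :
      (C, x, e) ∈ arms → Resume F r (.ctor C r') →
      ResumeEnv F E E' → Resume F r' r'' → Eval ((x, r'') :: E') e r₀ → Resume F r₀ r₁ →
      Resume F (.caseOf E r arms) r₁
  | caseIndet {E E' r r' arms} :
      Resume F r r' → (∀ C x e r'', (C, x, e) ∈ arms → r' ≠ .ctor C r'') →
      ResumeEnv F E E' →
      Resume F (.caseOf E r arms) (.caseOf E' r' arms)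
  | unwrap {C r r'} : Resume F r (.ctor C r') → Resume F (.unwrap C r) r'
  | unwrapIndet {C r r'} :
      Resume F r r' → (∀ C' r'', r' ≠ .ctor C' r'') → Resume F (.unwrap C r) (.unwrap C r')

/-- Environment resumption `F ⊢ E ⇒ E'`. -/
inductive ResumeEnv (F : Filling) : Env → Env → Prop
  | nil : ResumeEnv F [] []
  | cons {E E' x r r'} :
      ResumeEnv F E E' → Resume F r r' → ResumeEnv F ((x, r) :: E) ((x, r') :: E')

end

/-- Live evaluation `E; F ⊢ e ⇒ r`: evaluation followed by resumption. -/
def LiveEval (E : Env) (F : Filling) (e : Exp) (r : Result) : Prop :=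
  ∃ r₀, Eval E e r₀ ∧ Resume F r₀ r

/-! ## Example and constraint satisfaction -/

/-- Example satisfaction `F ⊢ r ⊨ ex`. -/
inductive ExSat (F : Filling) : Result → Ex → Prop
  | top {r} : ExSat F r .top
  | unit : ExSat F .unit .unit
  | pair {r₁ r₂ ex₁ ex₂} :
      ExSat F r₁ ex₁ → ExSat F r₂ ex₂ → ExSat F (.pair r₁ r₂) (.pair ex₁ ex₂)
  | ctor {C r ex} : ExSat F r ex → ExSat F (.ctor C r) (.ctor C ex)
  | io {r₁ v r ex} :
      Resume F (.app r₁ v.toResult) r → ExSat F r ex → ExSat F r₁ (.io v ex)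

/-- Example constraint satisfaction `F ⊢ e ⊨ X`. -/
def WorldSat (F : Filling) (e : Exp) (X : Worlds) : Prop :=
  ∀ w ∈ X, ∃ r, LiveEval w.1 F e r ∧ ExSat F r w.2

/-- Constraint satisfaction `F ⊨ (F₀; U)`: `F` extends `F₀`, and every hole constrained by `U`
satisfies its examples under `F`. -/
def ConstraintSat (F : Filling) (K : Constraints) : Prop :=
  (∀ h e, K.F.lookup h = some e → F.lookup h = some e) ∧
  ∀ h X, K.U.lookup h = some X → WorldSat F (.hole h) X

/-! ## Syntactic constraint merging -/

/-- `F₁ ⊕ F₂ = F`. -/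
def MergeF (F₁ F₂ F : Filling) : Prop :=
  (∀ h e₁ e₂, F₁.lookup h = some e₁ → F₂.lookup h = some e₂ → e₁ = e₂) ∧ F = F₁ ∪ F₂

/-- Union of the example constraints that two maps give to one hole. -/
def unionWorlds : Option Worlds → Option Worlds → Option Worlds
  | none, o => o
  | some X, none => some X
  | some X, some Y => some (X ∪ Y)

/-- `U₁ ⊕ U₂ = U`. -/
def MergeU (U₁ U₂ U : Unfilled) : Prop :=
  ∀ h, U.lookup h = unionWorlds (U₁.lookup h) (U₂.lookup h)

/-- `K₁ ⊕ K₂ = K`. -/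
def MergeK (K₁ K₂ K : Constraints) : Prop :=
  MergeF K₁.F K₂.F K.F ∧ MergeU K₁.U K₂.U K.U

/-- `K₁ ⊕ ⋯ ⊕ Kₙ = K`. -/
inductive MergeList : List Constraints → Constraints → Prop
  | nil : MergeList [] .empty
  | cons {K Ks K' K''} : MergeList Ks K' → MergeK K K' K'' → MergeList (K :: Ks) K''

/-! ## Live unevaluation and bidirectional example checking -/

/-- An interpretation of the non-deterministic function `Guesses(Δ, Σ, r)`, which proposes hole
fillings that may resolve the scrutinee `r`. -/
abbrev GuessFn := HoleCtx → DataCtx → Result → Set Filling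

/-- Live unevaluation `Σ; Δ; F ⊢ r ⇐ ex ⊣ K`. In the rules `fix`, `caseOf` and `caseGuess`, checking
an expression against one world is spelled out as live evaluation followed by unevaluation. -/
inductive Uneval (Gs : GuessFn) (Sg : DataCtx) (Δ : HoleCtx) :
    Filling → Result → Ex → Constraints → Prop
  | top {F r} : Uneval Gs Sg Δ F r .top .empty
  | unit {F} : Uneval Gs Sg Δ F .unit .unit .empty
  | pair {F r₁ r₂ ex₁ ex₂ K₁ K₂ K} :
      Uneval Gs Sg Δ F r₁ ex₁ K₁ → Uneval Gs Sg Δ F r₂ ex₂ K₂ → MergeK K₁ K₂ K →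
      Uneval Gs Sg Δ F (.pair r₁ r₂) (.pair ex₁ ex₂) K
  | ctor {F C r ex K} :
      Uneval Gs Sg Δ F r ex K → Uneval Gs Sg Δ F (.ctor C r) (.ctor C ex) K
  | fix {F E f x e v ex r K} :
      LiveEval ((x, v.toResult) :: (f, .fix E f x e) :: E) F e r → Uneval Gs Sg Δ F r ex K →
      Uneval Gs Sg Δ F (.fix E f x e) (.io v ex) K
  | hole {F E h ex} :
      Uneval Gs Sg Δ F (.hole E h) ex ⟨∅, Finmap.singleton h {(E, ex)}⟩
  | app {F r₁ r₂ v₂ ex K} :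
      Downcast r₂ v₂ → Uneval Gs Sg Δ F r₁ (.io v₂ ex) K → Uneval Gs Sg Δ F (.app r₁ r₂) ex K
  | prjFst {F r ex K} :
      Uneval Gs Sg Δ F r (.pair ex .top) K → Uneval Gs Sg Δ F (.prj .fst r) ex K
  | prjSnd {F r ex K} :
      Uneval Gs Sg Δ F r (.pair .top ex) K → Uneval Gs Sg Δ F (.prj .snd r) ex K
  | caseOf {F E r arms C x e r' ex K₁ K₂ K} :
      (C, x, e) ∈ arms → Uneval Gs Sg Δ F r (.ctor C .top) K₁ →
      LiveEval ((x, .unwrap C r) :: E) F e r' → Uneval Gs Sg Δ F r' ex K₂ → MergeK K₁ K₂ K →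
      Uneval Gs Sg Δ F (.caseOf E r arms) ex K
  | unwrap {F C r ex K} :
      Uneval Gs Sg Δ F r (.ctor C ex) K → Uneval Gs Sg Δ F (.unwrap C r) ex K
  | caseGuess {F F_g F₁ E r arms C x e r' r'' ex K K'} :
      (C, x, e) ∈ arms → F_g ∈ Gs Δ Sg r → MergeF F F_g F₁ → Resume F₁ r (.ctor C r') →
      LiveEval ((x, r') :: E) F₁ e r'' → Uneval Gs Sg Δ F₁ r'' ex K →
      MergeK ⟨F_g, ∅⟩ K K' →
      Uneval Gs Sg Δ F (.caseOf E r arms) ex K'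

/-- Live bidirectional example checking `Σ; Δ; F ⊢ e ⇌ X ⊣ K`. The list `ws` enumerates `X`,
together with the constraints that each world gives rise to. -/
def LiveCheck (Gs : GuessFn) (Sg : DataCtx) (Δ : HoleCtx) (F : Filling) (e : Exp) (X : Worlds)
    (K : Constraints) : Prop :=
  ∃ ws : List (World × Constraints),
    (ws.map Prod.fst).toFinset = X ∧
    (∀ p ∈ ws, ∃ r, LiveEval p.1.1 F e r ∧ Uneval Gs Sg Δ F r p.1.2 p.2) ∧
    MergeList (ws.map Prod.snd) K

/-! ## Semantic constraint merging -/

/-- `Resolve(F, h ↦ X) = K`. -/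
inductive Resolve (Gs : GuessFn) (Sg : DataCtx) (Δ : HoleCtx) (F : Filling) (h : Hole)
    (X : Worlds) : Constraints → Prop
  | filled {e K} : F.lookup h = some e → LiveCheck Gs Sg Δ F e X K → Resolve Gs Sg Δ F h X K
  | unfilled : F.lookup h = none → Resolve Gs Sg Δ F h X ⟨∅, Finmap.singleton h X⟩

/-- `Step(K) = K'`. The list `ks` enumerates the domain of `K.U`, together with the constraints
that each entry is resolved to. -/
def Step (Gs : GuessFn) (Sg : DataCtx) (Δ : HoleCtx) (K K' : Constraints) : Prop :=
  ∃ (ks : List (Hole × Constraints)) (K'' : Constraints),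
    (ks.map Prod.fst).Nodup ∧
    (∀ h, h ∈ ks.map Prod.fst ↔ h ∈ K.U) ∧
    (∀ p ∈ ks, ∀ X, K.U.lookup p.1 = some X → Resolve Gs Sg Δ K.F p.1 X p.2) ∧
    MergeList (ks.map Prod.snd) K'' ∧
    MergeK ⟨K.F, ∅⟩ K'' K'

/-- `Merge(K) = K'`: iterate `Step` until nothing changes. -/
inductive SemMerge (Gs : GuessFn) (Sg : DataCtx) (Δ : HoleCtx) : Constraints → Constraints → Prop
  | next {K K' K''} :
      Step Gs Sg Δ K K' → K ≠ K' → SemMerge Gs Sg Δ K' K'' → SemMerge Gs Sg Δ K K''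
  | stop_here {K K'} : Step Gs Sg Δ K K' → K = K' → SemMerge Gs Sg Δ K K'

/-! ## Hole synthesis -/

/-- Type-directed guessing `Σ; Γ ⊢ T ⇝ e` of expressions without holes. -/
inductive Guess (Sg : DataCtx) : Ctx → Ty → Exp → Prop
  | unit {Γ} : Guess Sg Γ .unit .unit
  | pair {Γ T₁ T₂ e₁ e₂} :
      Guess Sg Γ T₁ e₁ → Guess Sg Γ T₂ e₂ → Guess Sg Γ (.pair T₁ T₂) (.pair e₁ e₂)
  | ctor {Γ C T D e} : Sg.HasCtor C T D → Guess Sg Γ T e → Guess Sg Γ (.data D) (.ctor C e)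
  | fix {Γ T₁ T₂ f x e} :
      Guess Sg ((x, T₁) :: (f, .arrow T₁ T₂) :: Γ) T₂ e →
      Guess Sg Γ (.arrow T₁ T₂) (.fix f x e)
  | caseOf {Γ T D cs e arms} :
      (D, cs) ∈ Sg → Guess Sg Γ (.data D) e → arms.map Prod.fst = cs.map Prod.fst →
      (∀ C T' x e', (C, T') ∈ cs → (C, x, e') ∈ arms → Guess Sg ((x, T') :: Γ) T e') →
      Guess Sg Γ T (.caseOf e arms)
  | var {Γ T x} : List.lookup x Γ = some T → Guess Sg Γ T (.var x)
  | app {Γ T T₂ e₁ e₂} :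
      Guess Sg Γ (.arrow T₂ T) e₁ → Guess Sg Γ T₂ e₂ → Guess Sg Γ T (.app e₁ e₂)
  | prj {Γ T₁ T₂ i e} : Guess Sg Γ (.pair T₁ T₂) e → Guess Sg Γ (i.pick T₁ T₂) (.prj i e)

/-- `Filter(X)`: remove the top examples. -/
def filterTop (X : Worlds) : Worlds :=
  open Classical in X.filter fun w => w.2 ≠ .top

/-- Refinement `Σ; Δ; Γ ⊢ T ⊨ X ⇝ e ⊣ G`. A fresh hole is one outside the domain of `Δ`, and the
fresh holes of one rule are distinct. The lists `L` enumerate the filtered examples. -/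
inductive Refine (Sg : DataCtx) (Δ : HoleCtx) (Γ : Ctx) (X : Worlds) :
    Ty → Exp → List Goal → Prop
  | unit : (∀ w ∈ filterTop X, w.2 = .unit) → Refine Sg Δ Γ X .unit .unit []
  | pair {T₁ T₂ h₁ h₂} (L : List (Env × Ex × Ex)) :
      filterTop X = (L.map fun l => (l.1, Ex.pair l.2.1 l.2.2)).toFinset →
      h₁ ∉ Δ → h₂ ∉ Δ → h₁ ≠ h₂ →
      Refine Sg Δ Γ X (.pair T₁ T₂) (.pair (.hole h₁) (.hole h₂))
        [⟨h₁, Γ, T₁, (L.map fun l => (l.1, l.2.1)).toFinset⟩,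
         ⟨h₂, Γ, T₂, (L.map fun l => (l.1, l.2.2)).toFinset⟩]
  | ctor {C T D h₁} (L : List (Env × Ex)) :
      filterTop X = (L.map fun l => (l.1, Ex.ctor C l.2)).toFinset →
      Sg.HasCtor C T D → h₁ ∉ Δ →
      Refine Sg Δ Γ X (.data D) (.ctor C (.hole h₁)) [⟨h₁, Γ, T, L.toFinset⟩]
  | fix {T₁ T₂ f x h₁} (L : List (Env × Val × Ex)) :
      filterTop X = (L.map fun l => (l.1, Ex.io l.2.1 l.2.2)).toFinset →
      h₁ ∉ Δ →
      Refine Sg Δ Γ X (.arrow T₁ T₂) (.fix f x (.hole h₁))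
        [⟨h₁, (x, T₁) :: (f, .arrow T₁ T₂) :: Γ, T₂,
          (L.map fun l =>
            ((x, l.2.1.toResult) :: (f, Result.fix l.1 f x (.hole h₁)) :: l.1, l.2.2)).toFinset⟩]

/-- Constructor simplification of `C⁻¹ r`: the argument `r'` if `r = C r'`, and `C⁻¹ r` otherwise. -/
def collapse (C : Ctor) : Result → Result
  | .ctor C' r' => if C' = C then r' else .unwrap C (.ctor C' r')
  | r => .unwrap C r

/-- The data that branching attaches to one (filtered) example `(E, ex)`: the result `r` of the
scrutinee, the constructor `C` of the branch chosen for it, and the constraints `K` under which the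
scrutinee is a `C`. -/
structure Choice where
  E : Env
  ex : Ex
  r : Result
  C : Ctor
  K : Constraints

/-- The data of one branch: constructor, its argument type, pattern variable, and fresh hole. -/
structure Arm where
  C : Ctor
  T : Ty
  x : Var
  h : Hole

/-- The examples that the choices `J` distribute to the branch `a`. -/
def Arm.worlds (a : Arm) (J : List Choice) : Worlds :=
  ((J.filter fun j => j.C = a.C).map fun j => ((a.x, collapse a.C j.r) :: j.E, j.ex)).toFinset

/-- Branching `Σ; Δ; F; Γ ⊢ T ⊨ X ⇝ e ⊣ G; K`. -/
inductive Branch (Gs : GuessFn) (Sg : DataCtx) (Δ : HoleCtx) (F : Filling) (Γ : Ctx)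
    (X : Worlds) (T : Ty) : Exp → List Goal → Constraints → Prop
  | mk {D cs e K} (J : List Choice) (as : List Arm) :
      (D, cs) ∈ Sg → Guess Sg Γ (.data D) e →
      filterTop X = (J.map fun j => (j.E, j.ex)).toFinset →
      (∀ j ∈ J, Eval j.E e j.r ∧ j.C ∈ cs.map Prod.fst ∧
        LiveCheck Gs Sg Δ F e {(j.E, Ex.ctor j.C .top)} j.K) →
      (as.map fun a => (a.C, a.T)) = cs →
      (∀ a ∈ as, a.h ∉ Δ) → (as.map Arm.h).Nodup →
      MergeList (J.map Choice.K) K →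
      Branch Gs Sg Δ F Γ X T (.caseOf e (as.map fun a => (a.C, a.x, .hole a.h)))
        (as.map fun a => ⟨a.h, (a.x, a.T) :: Γ, T, a.worlds J⟩) K

/-- The unfilled holes `h₁ ↦ X₁, …, hₙ ↦ Xₙ` of a list of goals. -/
def goalsUnfilled (G : List Goal) : Unfilled :=
  (G.map fun g => (⟨g.h, g.X⟩ : Σ _ : Hole, Worlds)).toFinmap

/-- The hole types `h₁ ↦ (Γ₁ ⊢ T₁), …, hₙ ↦ (Γₙ ⊢ Tₙ)` of a list of goals. -/
def goalsCtx (G : List Goal) : HoleCtx :=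
  (G.map fun g => (⟨g.h, (g.Γ, g.T)⟩ : Σ _ : Hole, Ctx × Ty)).toFinmap

/-- Hole synthesis: under `Σ; Δ; F`, the goal `h : (Γ ⊢ T) ⊨ X` yields the constraints `K` and the
types `Δ'` of fresh holes. -/
inductive Fill (Gs : GuessFn) (Sg : DataCtx) (Δ : HoleCtx) (h : Hole) (F : Filling) (Γ : Ctx)
    (X : Worlds) (T : Ty) : Constraints → HoleCtx → Prop
  | guessAndCheck {e K K'} :
      Guess Sg Γ T e → LiveCheck Gs Sg Δ (F.insert h e) e X K →
      MergeK ⟨Finmap.singleton h e, ∅⟩ K K' →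
      Fill Gs Sg Δ h F Γ X T K' ∅
  | defer :
      X.Nonempty → (∀ w ∈ X, w.2 = .top) →
      Fill Gs Sg Δ h F Γ X T ⟨Finmap.singleton h (.hole h), ∅⟩ ∅
  | refine {e G} :
      Refine Sg Δ Γ X T e G →
      Fill Gs Sg Δ h F Γ X T ⟨Finmap.singleton h e, goalsUnfilled G⟩ (goalsCtx G)
  | branch {e G K K'} :
      Branch Gs Sg Δ F Γ X T e G K →
      MergeK ⟨Finmap.singleton h e, goalsUnfilled G⟩ K K' →
      Fill Gs Sg Δ h F Γ X T K' (goalsCtx G)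

/-- Constraint solving: under `Σ; Δ`, `Solve(K) = F; Δ'`. -/
inductive Solve (Gs : GuessFn) (Sg : DataCtx) :
    HoleCtx → Constraints → Filling → HoleCtx → Prop
  | done {Δ F} : Solve Gs Sg Δ ⟨F, ∅⟩ F Δ
  | one {Δ Δ' Δ'' h F F' U X Γ T K K₁ K'} :
      U.lookup h = some X → Δ.lookup h = some (Γ, T) →
      Fill Gs Sg Δ h F Γ X T K Δ' →
      MergeK ⟨F, U.erase h⟩ K K₁ → SemMerge Gs Sg (Δ ∪ Δ') K₁ K' →
      Solve Gs Sg (Δ ∪ Δ') K' F' Δ'' →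
      Solve Gs Sg Δ ⟨F, U⟩ F' Δ''

/-! ## Totality of evaluation and resumption -/

/-- Immediate subexpressions. -/
inductive ImmSub : Exp → Exp → Prop
  | fix {f x e} : ImmSub e (.fix f x e)
  | appFun {e₁ e₂} : ImmSub e₁ (.app e₁ e₂)
  | appArg {e₁ e₂} : ImmSub e₂ (.app e₁ e₂)
  | pairFst {e₁ e₂} : ImmSub e₁ (.pair e₁ e₂)
  | pairSnd {e₁ e₂} : ImmSub e₂ (.pair e₁ e₂)
  | prj {i e} : ImmSub e (.prj i e)
  | ctor {C e} : ImmSub e (.ctor C e)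
  | scrut {e arms} : ImmSub e (.caseOf e arms)
  | arm {e arms C x e'} : (C, x, e') ∈ arms → ImmSub e' (.caseOf e arms)

mutual

/-- The code stored in the closures of a result is drawn from the set `P` of expressions. -/
inductive CodeIn (P : Set Exp) : Result → Prop
  | fix {E f x e} : EnvCodeIn P E → Exp.fix f x e ∈ P → CodeIn P (.fix E f x e)
  | unit : CodeIn P .unit
  | pair {r₁ r₂} : CodeIn P r₁ → CodeIn P r₂ → CodeIn P (.pair r₁ r₂)
  | ctor {C r} : CodeIn P r → CodeIn P (.ctor C r)
  | hole {E h} : EnvCodeIn P E → CodeIn P (.hole E h)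
  | app {r₁ r₂} : CodeIn P r₁ → CodeIn P r₂ → CodeIn P (.app r₁ r₂)
  | prj {i r} : CodeIn P r → CodeIn P (.prj i r)
  | caseOf {E r e arms} :
      EnvCodeIn P E → CodeIn P r → Exp.caseOf e arms ∈ P → CodeIn P (.caseOf E r arms)
  | unwrap {C r} : CodeIn P r → CodeIn P (.unwrap C r)

/-- The code stored in an environment is drawn from `P`. -/
inductive EnvCodeIn (P : Set Exp) : Env → Prop
  | nil : EnvCodeIn P []
  | cons {E x r} : EnvCodeIn P E → CodeIn P r → EnvCodeIn P ((x, r) :: E)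

end

/-- Evaluation and resumption are total for the program at hand: there is a set `P` of expressions,
closed under subexpressions and containing the code of the examples in `U` and of the filling `F`,
such that, for code drawn from `P`, well-typed expressions evaluate in well-typed environments, and
well-typed results resume under `F`. -/
def Total (Sg : DataCtx) (Δ : HoleCtx) (F : Filling) (U : Unfilled) : Prop :=
  ∃ P : Set Exp,
    (∀ e e', ImmSub e' e → e ∈ P → e' ∈ P) ∧
    (∀ h e, F.lookup h = some e → e ∈ P) ∧
    (∀ h X, U.lookup h = some X → ∀ w ∈ X, EnvCodeIn P w.1) ∧
    (∀ Γ E e T, e ∈ P → EnvCodeIn P E → EnvTyped Sg Δ E Γ → HasType Sg Δ Γ e T →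
      ∃ r, Eval E e r) ∧
    (∀ r T, CodeIn P r → ResultTyped Sg Δ r T → ∃ r', Resume F r r')

end Smyth

end

noncomputable section

namespace Smyth

/-! ## A confluent rewriting system containing evaluation and resumption -/

/-- Terms of the rewriting system: results, environments and suspended evaluations `susp E e`. -/
inductive Th where
  | nil
  | cons (x : Var) (r E : Th)
  | susp (E : Th) (e : Exp)
  | unit
  | pair (a b : Th)
  | ctor (C : Ctor) (a : Th)
  | app (a b : Th)
  | prj (i : Side) (a : Th)
  | caseOf (E a : Th) (arms : List (Ctor × Var × Exp))
  | unwrap (C : Ctor) (a : Th)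

/-- Contraction of a redex at the root. -/
inductive Root (F : Filling) : Th → Th → Prop
  | unit {E} : Root F (.susp E .unit) .unit
  | pair {E e₁ e₂} : Root F (.susp E (.pair e₁ e₂)) (.pair (.susp E e₁) (.susp E e₂))
  | ctor {E C e} : Root F (.susp E (.ctor C e)) (.ctor C (.susp E e))
  | app {E e₁ e₂} : Root F (.susp E (.app e₁ e₂)) (.app (.susp E e₁) (.susp E e₂))
  | prj {E i e} : Root F (.susp E (.prj i e)) (.prj i (.susp E e))
  | caseOf {E e arms} : Root F (.susp E (.caseOf e arms)) (.caseOf E (.susp E e) arms)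
  | hole {E h e} : F.lookup h = some e → e ≠ .hole h → Root F (.susp E (.hole h)) (.susp E e)
  | varHere {E x r} : Root F (.susp (.cons x r E) (.var x)) r
  | varThere {E x y r} : x ≠ y → Root F (.susp (.cons y r E) (.var x)) (.susp E (.var x))
  | beta {E f x e b} :
      Root F (.app (.susp E (.fix f x e)) b)
        (.susp (.cons x b (.cons f (.susp E (.fix f x e)) E)) e)
  | proj {i a b} : Root F (.prj i (.pair a b)) (i.pick a b)
  | branch {E C a arms x e} : (C, x, e) ∈ arms →
      (∀ x' e', (C, x', e') ∈ arms → x' = x ∧ e' = e) →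
      Root F (.caseOf E (.ctor C a) arms) (.susp (.cons x a E) e)
  | unwrap {C a} : Root F (.unwrap C (.ctor C a)) a

/-- Parallel reduction. With index `false` only proper subterms are reduced; with index `true` a
contraction at the root may follow. -/
inductive Par (F : Filling) : Bool → Th → Th → Prop
  | nil : Par F false .nil .nil
  | cons {x r r' E E'} : Par F true r r' → Par F true E E' →
      Par F false (.cons x r E) (.cons x r' E')
  | susp {E E' e} : Par F true E E' → Par F false (.susp E e) (.susp E' e)
  | unit : Par F false .unit .unit
  | pair {a a' b b'} : Par F true a a' → Par F true b b' → Par F false (.pair a b) (.pair a' b')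
  | ctor {C a a'} : Par F true a a' → Par F false (.ctor C a) (.ctor C a')
  | app {a a' b b'} : Par F true a a' → Par F true b b' → Par F false (.app a b) (.app a' b')
  | prj {i a a'} : Par F true a a' → Par F false (.prj i a) (.prj i a')
  | caseOf {E E' a a' arms} : Par F true E E' → Par F true a a' →
      Par F false (.caseOf E a arms) (.caseOf E' a' arms)
  | unwrap {C a a'} : Par F true a a' → Par F false (.unwrap C a) (.unwrap C a')
  | inner {a a'} : Par F false a a' → Par F true a a'
  | root {a a' b} : Par F false a a' → Root F a' b → Par F true a b

theorem Par.refl_false {F : Filling} (t : Th) : Par F false t t := by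
  induction t with
  | nil => exact .nil
  | cons x r E h₁ h₂ => exact .cons (.inner h₁) (.inner h₂)
  | susp E e h => exact .susp (.inner h)
  | unit => exact .unit
  | pair a b h₁ h₂ => exact .pair (.inner h₁) (.inner h₂)
  | ctor C a h => exact .ctor (.inner h)
  | app a b h₁ h₂ => exact .app (.inner h₁) (.inner h₂)
  | prj i a h => exact .prj (.inner h)
  | caseOf E a arms h₁ h₂ => exact .caseOf (.inner h₁) (.inner h₂)
  | unwrap C a h => exact .unwrap (.inner h)

theorem Par.refl {F : Filling} (t : Th) : Par F true t t := .inner (.refl_false t)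

theorem Root.par {F : Filling} {a b : Th} (h : Root F a b) : Par F true a b :=
  .root (.refl_false a) h

theorem Root.unique {F : Filling} {a b c : Th} (h₁ : Root F a b) (h₂ : Root F a c) : b = c := by
  cases h₁ <;> cases h₂ <;> try rfl
  · simp_all
  · contradiction
  · contradiction
  · rename_i h _ _ _ h'
    obtain ⟨rfl, rfl⟩ := h _ _ ‹_›
    rfl

theorem Par.susp_fix {F : Filling} {E f x e a} (h : Par F true (.susp E (.fix f x e)) a) :
    ∃ E', a = .susp E' (.fix f x e) ∧ Par F true E E' := by
  cases h with
  | inner h => cases h; exact ⟨_, rfl, ‹_›⟩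
  | root h hr => cases h; cases hr

theorem Par.pair_inv {F : Filling} {a b t} (h : Par F true (.pair a b) t) :
    ∃ a' b', t = .pair a' b' ∧ Par F true a a' ∧ Par F true b b' := by
  cases h with
  | inner h => cases h; exact ⟨_, _, rfl, ‹_›, ‹_›⟩
  | root h hr => cases h; cases hr

theorem Par.ctor_inv {F : Filling} {C a t} (h : Par F true (.ctor C a) t) :
    ∃ a', t = .ctor C a' ∧ Par F true a a' := by
  cases h with
  | inner h => cases h; exact ⟨_, rfl, ‹_›⟩
  | root h hr => cases h; cases hr

theorem Par.cons_inv {F : Filling} {x a b t} (h : Par F true (.cons x a b) t) :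
    ∃ a' b', t = .cons x a' b' ∧ Par F true a a' ∧ Par F true b b' := by
  cases h with
  | inner h => cases h; exact ⟨_, _, rfl, ‹_›, ‹_›⟩
  | root h hr => cases h; cases hr

theorem Root.par_false {F : Filling} {t s t'} (hr : Root F t s) (hp : Par F false t t') :
    ∃ s', Root F t' s' ∧ Par F true s s' := by
  cases hr with
  | unit => cases hp; exact ⟨_, .unit, .refl _⟩
  | pair =>
    cases hp with | susp h => exact ⟨_, .pair, .inner (.pair (.inner (.susp h)) (.inner (.susp h)))⟩
  | ctor => cases hp with | susp h => exact ⟨_, .ctor, .inner (.ctor (.inner (.susp h)))⟩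
  | app =>
    cases hp with | susp h => exact ⟨_, .app, .inner (.app (.inner (.susp h)) (.inner (.susp h)))⟩
  | prj => cases hp with | susp h => exact ⟨_, .prj, .inner (.prj (.inner (.susp h)))⟩
  | caseOf =>
    cases hp with | susp h => exact ⟨_, .caseOf, .inner (.caseOf h (.inner (.susp h)))⟩
  | hole h₁ h₂ => cases hp with | susp h => exact ⟨_, .hole h₁ h₂, .inner (.susp h)⟩
  | varHere =>
    cases hp with
    | susp h =>
      obtain ⟨a', b', rfl, ha, hb⟩ := h.cons_inv
      exact ⟨_, .varHere, ha⟩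
  | varThere hne =>
    cases hp with
    | susp h =>
      obtain ⟨a', b', rfl, ha, hb⟩ := h.cons_inv
      exact ⟨_, .varThere hne, .inner (.susp hb)⟩
  | beta =>
    cases hp with
    | app h₁ h₂ =>
      obtain ⟨E', rfl, hE⟩ := h₁.susp_fix
      exact ⟨_, .beta, .inner (.susp (.inner (.cons h₂ (.inner (.cons h₁ hE)))))⟩
  | proj =>
    rename_i i _ _
    cases hp with
    | prj h =>
      obtain ⟨a', b', rfl, ha, hb⟩ := h.pair_inv
      exact ⟨_, .proj, by cases i <;> assumption⟩
  | branch hm hu =>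
    cases hp with
    | caseOf h₁ h₂ =>
      obtain ⟨a', rfl, ha⟩ := h₂.ctor_inv
      exact ⟨_, .branch hm hu, .inner (.susp (.inner (.cons ha h₁)))⟩
  | unwrap =>
    cases hp with
    | unwrap h =>
      obtain ⟨a', rfl, ha⟩ := h.ctor_inv
      exact ⟨_, .unwrap, ha⟩

theorem Par.diamond {F : Filling} {i t a b} (ha : Par F i t a) (hb : Par F i t b) :
    ∃ c, Par F i a c ∧ Par F i b c := by
  induction ha generalizing b with
  | nil => cases hb; exact ⟨_, .nil, .nil⟩
  | cons _ _ ih₁ ih₂ =>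
    cases hb with
    | cons h₁ h₂ =>
      obtain ⟨c, hc, hc'⟩ := ih₁ h₁
      obtain ⟨d, hd, hd'⟩ := ih₂ h₂
      exact ⟨_, .cons hc hd, .cons hc' hd'⟩
  | susp _ ih =>
    cases hb with
    | susp h =>
      obtain ⟨c, hc, hc'⟩ := ih h
      exact ⟨_, .susp hc, .susp hc'⟩
  | unit => cases hb; exact ⟨_, .unit, .unit⟩
  | pair _ _ ih₁ ih₂ =>
    cases hb with
    | pair h₁ h₂ =>
      obtain ⟨c, hc, hc'⟩ := ih₁ h₁
      obtain ⟨d, hd, hd'⟩ := ih₂ h₂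
      exact ⟨_, .pair hc hd, .pair hc' hd'⟩
  | ctor _ ih =>
    cases hb with
    | ctor h =>
      obtain ⟨c, hc, hc'⟩ := ih h
      exact ⟨_, .ctor hc, .ctor hc'⟩
  | app _ _ ih₁ ih₂ =>
    cases hb with
    | app h₁ h₂ =>
      obtain ⟨c, hc, hc'⟩ := ih₁ h₁
      obtain ⟨d, hd, hd'⟩ := ih₂ h₂
      exact ⟨_, .app hc hd, .app hc' hd'⟩
  | prj _ ih =>
    cases hb with
    | prj h =>
      obtain ⟨c, hc, hc'⟩ := ih h
      exact ⟨_, .prj hc, .prj hc'⟩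
  | caseOf _ _ ih₁ ih₂ =>
    cases hb with
    | caseOf h₁ h₂ =>
      obtain ⟨c, hc, hc'⟩ := ih₁ h₁
      obtain ⟨d, hd, hd'⟩ := ih₂ h₂
      exact ⟨_, .caseOf hc hd, .caseOf hc' hd'⟩
  | unwrap _ ih =>
    cases hb with
    | unwrap h =>
      obtain ⟨c, hc, hc'⟩ := ih h
      exact ⟨_, .unwrap hc, .unwrap hc'⟩
  | inner _ ih =>
    cases hb with
    | inner h =>
      obtain ⟨c, hc, hc'⟩ := ih h
      exact ⟨_, .inner hc, .inner hc'⟩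
    | root h hr =>
      obtain ⟨c, hc, hc'⟩ := ih h
      obtain ⟨s, hs, hs'⟩ := hr.par_false hc'
      exact ⟨s, .root hc hs, hs'⟩
  | root _ hr ih =>
    cases hb with
    | inner h =>
      obtain ⟨c, hc, hc'⟩ := ih h
      obtain ⟨s, hs, hs'⟩ := hr.par_false hc
      exact ⟨s, hs', .root hc' hs⟩
    | root h hr' =>
      obtain ⟨c, hc, hc'⟩ := ih h
      obtain ⟨s, hs, hs'⟩ := hr.par_false hc
      obtain ⟨u, hu, hu'⟩ := hr'.par_false hc'
      obtain rfl := hs.unique hu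
      exact ⟨s, hs', hu'⟩

/-- Many-step reduction. -/
abbrev Steps (F : Filling) : Th → Th → Prop := Relation.ReflTransGen (Par F true)

/-- Two terms are convertible if they have a common reduct. -/
abbrev Conv (F : Filling) : Th → Th → Prop := Relation.Join (Steps F)

theorem Par.church_rosser {F : Filling} (a b c : Th) (hb : Par F true a b) (hc : Par F true a c) :
    ∃ d, Relation.ReflGen (Par F true) b d ∧ Steps F c d := by
  obtain ⟨d, hd, hd'⟩ := hb.diamond hc
  exact ⟨d, .single hd, .single hd'⟩

theorem Conv.symm {F : Filling} {a b} (h : Conv F a b) : Conv F b a :=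
  let ⟨c, h₁, h₂⟩ := h
  ⟨c, h₂, h₁⟩

theorem Conv.trans {F : Filling} {a b c} (h₁ : Conv F a b) (h₂ : Conv F b c) : Conv F a c :=
  (Relation.equivalence_join_reflTransGen Par.church_rosser).trans h₁ h₂

theorem Conv.ofSteps {F : Filling} {a b} (h : Steps F a b) : Conv F a b := ⟨b, h, .refl⟩

theorem Steps.root {F : Filling} {a b c} (h : Root F a b) (h' : Steps F b c) : Steps F a c :=
  .head h.par h'

theorem Steps.cons {F : Filling} {x a a' b b'} (h₁ : Steps F a a') (h₂ : Steps F b b') :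
    Steps F (.cons x a b) (.cons x a' b') :=
  (h₁.lift (fun a => Th.cons x a b) fun _ _ h => .inner (.cons h (.refl _))).trans
    (h₂.lift (fun b => Th.cons x a' b) fun _ _ h => .inner (.cons (.refl _) h))

theorem Steps.pair {F : Filling} {a a' b b'} (h₁ : Steps F a a') (h₂ : Steps F b b') :
    Steps F (.pair a b) (.pair a' b') :=
  (h₁.lift (fun a => Th.pair a b) fun _ _ h => .inner (.pair h (.refl _))).trans
    (h₂.lift (fun b => Th.pair a' b) fun _ _ h => .inner (.pair (.refl _) h))

theorem Steps.app {F : Filling} {a a' b b'} (h₁ : Steps F a a') (h₂ : Steps F b b') :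
    Steps F (.app a b) (.app a' b') :=
  (h₁.lift (fun a => Th.app a b) fun _ _ h => .inner (.app h (.refl _))).trans
    (h₂.lift (fun b => Th.app a' b) fun _ _ h => .inner (.app (.refl _) h))

theorem Steps.caseOf {F : Filling} {a a' b b' arms} (h₁ : Steps F a a') (h₂ : Steps F b b') :
    Steps F (.caseOf a b arms) (.caseOf a' b' arms) :=
  (h₁.lift (fun a => Th.caseOf a b arms) fun _ _ h => .inner (.caseOf h (.refl _))).trans
    (h₂.lift (fun b => Th.caseOf a' b arms) fun _ _ h => .inner (.caseOf (.refl _) h))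

theorem Steps.susp {F : Filling} {a a' e} (h : Steps F a a') :
    Steps F (.susp a e) (.susp a' e) :=
  h.lift (fun a => Th.susp a e) fun _ _ h => .inner (.susp h)

theorem Steps.ctor {F : Filling} {C a a'} (h : Steps F a a') :
    Steps F (.ctor C a) (.ctor C a') :=
  h.lift (fun a => Th.ctor C a) fun _ _ h => .inner (.ctor h)

theorem Steps.prj {F : Filling} {i a a'} (h : Steps F a a') :
    Steps F (.prj i a) (.prj i a') :=
  h.lift (fun a => Th.prj i a) fun _ _ h => .inner (.prj h)

theorem Steps.unwrap {F : Filling} {C a a'} (h : Steps F a a') :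
    Steps F (.unwrap C a) (.unwrap C a') :=
  h.lift (fun a => Th.unwrap C a) fun _ _ h => .inner (.unwrap h)

/-- Filling a hole is a reduction. -/
theorem Steps.fill {F : Filling} {E h e} (hF : F.lookup h = some e) :
    Steps F (.susp E (.hole h)) (.susp E e) := by
  by_cases he : e = .hole h
  · subst he; exact .refl
  · exact .root (.hole hF he) .refl

/-- Normal forms. -/
inductive Nf (F : Filling) : Th → Prop
  | nil : Nf F .nil
  | cons {x a b} : Nf F a → Nf F b → Nf F (.cons x a b)
  | fix {E f x e} : Nf F E → Nf F (.susp E (.fix f x e))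
  | hole {E h} : Nf F E → (F.lookup h = none ∨ F.lookup h = some (.hole h)) →
      Nf F (.susp E (.hole h))
  | unit : Nf F .unit
  | pair {a b} : Nf F a → Nf F b → Nf F (.pair a b)
  | ctor {C a} : Nf F a → Nf F (.ctor C a)
  | app {a b} : Nf F a → Nf F b → (∀ E f x e, a ≠ .susp E (.fix f x e)) → Nf F (.app a b)
  | prj {i a} : Nf F a → (∀ b c, a ≠ .pair b c) → Nf F (.prj i a)
  | caseOf {E a arms} : Nf F E → Nf F a → (∀ C x e b, (C, x, e) ∈ arms → a ≠ .ctor C b) →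
      Nf F (.caseOf E a arms)
  | unwrap {C a} : Nf F a → (∀ C' b, a ≠ .ctor C' b) → Nf F (.unwrap C a)

theorem Nf.par_eq {F : Filling} {t s i} (ht : Nf F t) (h : Par F i t s) : s = t := by
  have hr : ∀ {t s}, Nf F t → ¬ Root F t s := by
    intro t s ht hr
    cases hr <;> cases ht <;> grind
  induction h with
  | nil => rfl
  | unit => rfl
  | cons _ _ ih₁ ih₂ => cases ht with | cons h₁ h₂ => rw [ih₁ h₁, ih₂ h₂]
  | susp _ ih =>
    cases ht with
    | fix h => rw [ih h]
    | hole h => rw [ih h]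
  | pair _ _ ih₁ ih₂ => cases ht with | pair h₁ h₂ => rw [ih₁ h₁, ih₂ h₂]
  | ctor _ ih => cases ht with | ctor h => rw [ih h]
  | app _ _ ih₁ ih₂ => cases ht with | app h₁ h₂ => rw [ih₁ h₁, ih₂ h₂]
  | prj _ ih => cases ht with | prj h => rw [ih h]
  | caseOf _ _ ih₁ ih₂ => cases ht with | caseOf h₁ h₂ => rw [ih₁ h₁, ih₂ h₂]
  | unwrap _ ih => cases ht with | unwrap h => rw [ih h]
  | inner _ ih => exact ih ht
  | root _ h ih => rw [ih ht] at h; exact absurd h (hr ht)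

theorem Nf.steps_eq {F : Filling} {t s} (ht : Nf F t) (h : Steps F t s) : s = t := by
  induction h with
  | refl => rfl
  | tail _ h ih => subst ih; exact ht.par_eq h

theorem Conv.eq_of_nf {F : Filling} {a b} (h : Conv F a b) (ha : Nf F a) (hb : Nf F b) : a = b := by
  obtain ⟨c, h₁, h₂⟩ := h
  rw [← ha.steps_eq h₁, ← hb.steps_eq h₂]

mutual

/-- Results as terms. -/
def Result.toTh : Result → Th
  | .fix E f x e => .susp (envTh E) (.fix f x e)
  | .unit => .unit
  | .pair r₁ r₂ => .pair r₁.toTh r₂.toTh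
  | .ctor C r => .ctor C r.toTh
  | .hole E h => .susp (envTh E) (.hole h)
  | .app r₁ r₂ => .app r₁.toTh r₂.toTh
  | .prj i r => .prj i r.toTh
  | .caseOf E r arms => .caseOf (envTh E) r.toTh arms
  | .unwrap C r => .unwrap C r.toTh

/-- Environments as terms. -/
def envTh : List (Var × Result) → Th
  | [] => .nil
  | (x, r) :: E => .cons x r.toTh (envTh E)

end

mutual

theorem Result.toTh_inj : ∀ r s : Result, r.toTh = s.toTh → r = s
  | .fix E f x e, s, h => by
    cases s <;> simp [Result.toTh] at h
    obtain ⟨h, rfl, rfl, rfl⟩ := h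
    rw [envTh_inj _ _ h]
  | .unit, s, h => by cases s <;> simp [Result.toTh] at h ⊢
  | .pair r₁ r₂, s, h => by
    cases s <;> simp [Result.toTh] at h
    rw [Result.toTh_inj _ _ h.1, Result.toTh_inj _ _ h.2]
  | .ctor C r, s, h => by
    cases s <;> simp [Result.toTh] at h
    rw [h.1, Result.toTh_inj _ _ h.2]
  | .hole E n, s, h => by
    cases s <;> simp [Result.toTh] at h
    rw [h.2, envTh_inj _ _ h.1]
  | .app r₁ r₂, s, h => by
    cases s <;> simp [Result.toTh] at h
    rw [Result.toTh_inj _ _ h.1, Result.toTh_inj _ _ h.2]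
  | .prj i r, s, h => by
    cases s <;> simp [Result.toTh] at h
    rw [h.1, Result.toTh_inj _ _ h.2]
  | .caseOf E r arms, s, h => by
    cases s <;> simp [Result.toTh] at h
    rw [envTh_inj _ _ h.1, Result.toTh_inj _ _ h.2.1, h.2.2]
  | .unwrap C r, s, h => by
    cases s <;> simp [Result.toTh] at h
    rw [h.1, Result.toTh_inj _ _ h.2]

theorem envTh_inj : ∀ E E' : List (Var × Result), envTh E = envTh E' → E = E'
  | [], E', h => by
    cases E' with
    | nil => rfl
    | cons p E' => simp [envTh] at h
  | (x, r) :: E, E', h => by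
    cases E' with
    | nil => simp [envTh] at h
    | cons p E' =>
      simp [envTh] at h
      obtain ⟨rfl, h₁, h₂⟩ := h
      rw [envTh_inj _ _ h₂, Result.toTh_inj _ _ h₁]

end

theorem Steps.var {F : Filling} {x r} : ∀ {E : Env}, List.lookup x E = some r →
    Steps F (.susp (envTh E) (.var x)) r.toTh
  | [], h => by simp at h
  | (y, s) :: E, h => by
    rw [envTh]
    by_cases hxy : x = y
    · subst hxy
      simp at h
      subst h
      exact .root .varHere .refl
    · have : (x == y) = false := by simpa using hxy
      rw [List.lookup_cons, this] at h
      exact .root (.varThere hxy) (Steps.var h)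

/-! ## Datatype contexts -/

theorem DataCtx.WellFormed.data_unique {Sg : DataCtx} (hSg : Sg.WellFormed) {D cs cs'}
    (h : (D, cs) ∈ Sg) (h' : (D, cs') ∈ Sg) : cs = cs' := by
  have := List.inj_on_of_nodup_map hSg.1 h h' rfl
  simpa using this

theorem DataCtx.WellFormed.ctors_nodup {Sg : DataCtx} (hSg : Sg.WellFormed) {D cs}
    (h : (D, cs) ∈ Sg) : (cs.map Prod.fst).Nodup :=
  (List.nodup_flatMap.1 hSg.2).1 _ h

theorem DataCtx.WellFormed.mem_of_hasCtor {Sg : DataCtx} (hSg : Sg.WellFormed) {C T D cs}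
    (h : Sg.HasCtor C T D) (hD : (D, cs) ∈ Sg) : (C, T) ∈ cs := by
  obtain ⟨cs', h₁, h₂⟩ := h
  rwa [hSg.data_unique hD h₁]

theorem DataCtx.WellFormed.mem_unique {Sg : DataCtx} (hSg : Sg.WellFormed) {C T T' D cs}
    (hD : (D, cs) ∈ Sg) (h : (C, T) ∈ cs) (h' : (C, T') ∈ cs) : T = T' := by
  have := List.inj_on_of_nodup_map (hSg.ctors_nodup hD) h h' rfl
  simpa using this

theorem DataCtx.WellFormed.ctor_unique {Sg : DataCtx} (hSg : Sg.WellFormed) {C T T' D}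
    (h : Sg.HasCtor C T D) (h' : Sg.HasCtor C T' D) : T = T' := by
  obtain ⟨cs, h₁, h₂⟩ := h
  exact hSg.mem_unique h₁ h₂ (hSg.mem_of_hasCtor h' h₁)

/-- The branches of a well-typed case expression have distinct constructors. -/
theorem DataCtx.WellFormed.arm_unique {Sg : DataCtx} (hSg : Sg.WellFormed) {D cs}
    {arms : List (Ctor × Var × Exp)} (hD : (D, cs) ∈ Sg)
    (ha : arms.map Prod.fst = cs.map Prod.fst) {C x e} (h : (C, x, e) ∈ arms) (x' e')
    (h' : (C, x', e') ∈ arms) : x' = x ∧ e' = e := by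
  have hn : (arms.map Prod.fst).Nodup := ha ▸ hSg.ctors_nodup hD
  have := List.inj_on_of_nodup_map hn h' h rfl
  simpa using this

/-! ## Good results -/

/-- A filling that extends `F₀`. -/
def Extends (F F₀ : Filling) : Prop := ∀ h e, F₀.lookup h = some e → F.lookup h = some e

/-- The totality assumption for a fixed set `P` of code, together with the typing assumptions. -/
structure TotalOn (Sg : DataCtx) (Δ : HoleCtx) (F : Filling) (P : Set Exp) : Prop where
  wf : Sg.WellFormed
  typed : FillingTyped Sg Δ F
  sub : ∀ {e e'}, ImmSub e' e → e ∈ P → e' ∈ P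
  code : ∀ {h e}, F.lookup h = some e → e ∈ P
  eval : ∀ {Γ E e T}, e ∈ P → EnvCodeIn P E → EnvTyped Sg Δ E Γ → HasType Sg Δ Γ e T →
    ∃ r, Eval E e r
  resume : ∀ {r T}, CodeIn P r → ResultTyped Sg Δ r T → ∃ r', Resume F r r'

mutual

/-- Typing of results with code in `P`, where an inverse constructor application is allowed if its
argument resumes under `F` to an application of that constructor. -/
inductive Good (Sg : DataCtx) (Δ : HoleCtx) (F : Filling) (P : Set Exp) : Result → Ty → Prop
  | fix {Γ E f x e T} : GoodEnv Sg Δ F P E Γ → HasType Sg Δ Γ (.fix f x e) T → .fix f x e ∈ P →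
      Good Sg Δ F P (.fix E f x e) T
  | hole {Γ E h T} : Δ.lookup h = some (Γ, T) → GoodEnv Sg Δ F P E Γ → Good Sg Δ F P (.hole E h) T
  | unit : Good Sg Δ F P .unit .unit
  | pair {r₁ r₂ T₁ T₂} : Good Sg Δ F P r₁ T₁ → Good Sg Δ F P r₂ T₂ →
      Good Sg Δ F P (.pair r₁ r₂) (.pair T₁ T₂)
  | ctor {C r T D} : Sg.HasCtor C T D → Good Sg Δ F P r T → Good Sg Δ F P (.ctor C r) (.data D)
  | app {r₁ r₂ T₂ T} : Good Sg Δ F P r₁ (.arrow T₂ T) → Good Sg Δ F P r₂ T₂ →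
      Good Sg Δ F P (.app r₁ r₂) T
  | prj {i r T₁ T₂} : Good Sg Δ F P r (.pair T₁ T₂) → Good Sg Δ F P (.prj i r) (i.pick T₁ T₂)
  | caseOf {Γ E r arms D cs T e} : Good Sg Δ F P r (.data D) → (D, cs) ∈ Sg →
      GoodEnv Sg Δ F P E Γ → arms.map Prod.fst = cs.map Prod.fst →
      (∀ C T' x e', (C, T') ∈ cs → (C, x, e') ∈ arms → HasType Sg Δ ((x, T') :: Γ) e' T) →
      .caseOf e arms ∈ P → Good Sg Δ F P (.caseOf E r arms) T
  | unwrap {C r r' T D} : Sg.HasCtor C T D → Good Sg Δ F P r (.data D) →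
      Resume F r (.ctor C r') → Steps F r.toTh (.ctor C r'.toTh) → Good Sg Δ F P r' T →
      Good Sg Δ F P (.unwrap C r) T

/-- Typing of environments that consist of good results. -/
inductive GoodEnv (Sg : DataCtx) (Δ : HoleCtx) (F : Filling) (P : Set Exp) : Env → Ctx → Prop
  | nil : GoodEnv Sg Δ F P [] []
  | cons {E Γ x r T} : GoodEnv Sg Δ F P E Γ → Good Sg Δ F P r T →
      GoodEnv Sg Δ F P ((x, r) :: E) ((x, T) :: Γ)

end

section

variable {Sg : DataCtx} {Δ : HoleCtx} {F : Filling} {P : Set Exp}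

theorem GoodEnv.lookup {x r T} : ∀ {E Γ}, GoodEnv Sg Δ F P E Γ → List.lookup x E = some r →
    List.lookup x Γ = some T → Good Sg Δ F P r T
  | _, _, .nil, h, _ => by simp at h
  | _, _, .cons (x := y) hE hr, h, h' => by
    rw [List.lookup_cons] at h h'
    split at h
    · simp_all
    · simp_all
      exact hE.lookup h h'

theorem Good.pick {i : Side} {r₁ r₂ T₁ T₂} (h₁ : Good Sg Δ F P r₁ T₁) (h₂ : Good Sg Δ F P r₂ T₂) :
    Good Sg Δ F P (i.pick r₁ r₂) (i.pick T₁ T₂) := by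
  cases i <;> assumption

theorem Result.toTh_pick (i : Side) (r₁ r₂ : Result) :
    (i.pick r₁ r₂).toTh = i.pick r₁.toTh r₂.toTh := by
  cases i <;> rfl

/-- Evaluation preserves goodness and is contained in reduction. -/
theorem TotalOn.eval_good (S : TotalOn Sg Δ F P) {E e r} (h : Eval E e r) :
    ∀ {Γ T}, GoodEnv Sg Δ F P E Γ → HasType Sg Δ Γ e T → e ∈ P →
      Good Sg Δ F P r T ∧ Steps F (.susp (envTh E) e) r.toTh := by
  induction h with
  | fix => intro Γ T hE ht hP; exact ⟨.fix hE ht hP, .refl⟩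
  | var h =>
    intro Γ T hE ht hP
    cases ht with
    | var h' => exact ⟨hE.lookup h h', .var h⟩
  | hole =>
    intro Γ T hE ht hP
    cases ht with
    | hole h' => exact ⟨.hole h' hE, .refl⟩
  | unit =>
    intro Γ T hE ht hP
    cases ht
    exact ⟨.unit, .root .unit .refl⟩
  | pair _ _ ih₁ ih₂ =>
    intro Γ T hE ht hP
    cases ht with
    | pair h₁ h₂ =>
      obtain ⟨g₁, s₁⟩ := ih₁ hE h₁ (S.sub .pairFst hP)
      obtain ⟨g₂, s₂⟩ := ih₂ hE h₂ (S.sub .pairSnd hP)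
      exact ⟨.pair g₁ g₂, .root .pair (.pair s₁ s₂)⟩
  | ctor _ ih =>
    intro Γ T hE ht hP
    cases ht with
    | ctor hC h =>
      obtain ⟨g, s⟩ := ih hE h (S.sub .ctor hP)
      exact ⟨.ctor hC g, .root .ctor (.ctor s)⟩
  | app _ _ _ ih₁ ih₂ ih₃ =>
    intro Γ T hE ht hP
    cases ht with
    | app h₁ h₂ =>
      obtain ⟨g₁, s₁⟩ := ih₁ hE h₁ (S.sub .appFun hP)
      obtain ⟨g₂, s₂⟩ := ih₂ hE h₂ (S.sub .appArg hP)
      cases g₁ with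
      | fix hE' ht' hP' =>
        cases ht' with
        | fix ht₀ =>
          obtain ⟨g, s⟩ := ih₃ (.cons (.cons hE' (.fix hE' (.fix ht₀) hP')) g₂) ht₀
            (S.sub .fix hP')
          exact ⟨g, .root .app ((Steps.app s₁ s₂).trans (Steps.root .beta s))⟩
  | appIndet _ _ _ ih₁ ih₂ =>
    intro Γ T hE ht hP
    cases ht with
    | app h₁ h₂ =>
      obtain ⟨g₁, s₁⟩ := ih₁ hE h₁ (S.sub .appFun hP)
      obtain ⟨g₂, s₂⟩ := ih₂ hE h₂ (S.sub .appArg hP)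
      exact ⟨.app g₁ g₂, .root .app (.app s₁ s₂)⟩
  | prj _ ih =>
    intro Γ T hE ht hP
    cases ht with
    | prj h =>
      obtain ⟨g, s⟩ := ih hE h (S.sub .prj hP)
      cases g with
      | pair g₁ g₂ =>
        refine ⟨g₁.pick g₂, .root .prj ((Steps.prj s).trans (Steps.root .proj ?_))⟩
        rw [Result.toTh_pick]
  | prjIndet _ _ ih =>
    intro Γ T hE ht hP
    cases ht with
    | prj h =>
      obtain ⟨g, s⟩ := ih hE h (S.sub .prj hP)
      exact ⟨.prj g, .root .prj (.prj s)⟩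
  | caseOf hm _ _ ih₁ ih₂ =>
    intro Γ T hE ht hP
    cases ht with
    | caseOf h hD ha hb =>
      obtain ⟨g₁, s₁⟩ := ih₁ hE h (S.sub .scrut hP)
      cases g₁ with
      | ctor hC g =>
        obtain ⟨g₂, s₂⟩ := ih₂ (.cons hE g) (hb _ _ _ _ (S.wf.mem_of_hasCtor hC hD) hm)
          (S.sub (.arm hm) hP)
        exact ⟨g₂, .root .caseOf ((Steps.caseOf .refl s₁).trans
          (Steps.root (.branch hm (S.wf.arm_unique hD ha hm)) s₂))⟩
  | caseIndet _ _ ih =>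
    intro Γ T hE ht hP
    cases ht with
    | caseOf h hD ha hb =>
      obtain ⟨g₁, s₁⟩ := ih hE h (S.sub .scrut hP)
      exact ⟨.caseOf g₁ hD hE ha hb hP, .root .caseOf (.caseOf .refl s₁)⟩

/-- Resumption preserves goodness and is contained in reduction, provided that goodness of inverse
constructor applications is preserved. -/
theorem TotalOn.resume_good_of_unwrap (S : TotalOn Sg Δ F P) {F₀ : Filling} (hF : Extends F F₀)
    (hU : ∀ {C r r' T}, Good Sg Δ F P (.unwrap C r) T → Resume F₀ r r' →
      (∀ C' r'', r' ≠ .ctor C' r'') → (∀ T', Good Sg Δ F P r T' → Good Sg Δ F P r' T') →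
      Steps F r.toTh r'.toTh → Good Sg Δ F P (.unwrap C r') T)
    {r r'} (h : Resume F₀ r r') :
    ∀ {T}, Good Sg Δ F P r T → Good Sg Δ F P r' T ∧ Steps F r.toTh r'.toTh := by
  induction h using Resume.rec (motive_2 := fun E E' _ => ∀ {Γ}, GoodEnv Sg Δ F P E Γ →
    GoodEnv Sg Δ F P E' Γ ∧ Steps F (envTh E) (envTh E')) with
  | holeResume h₁ h₂ h₃ _ ih =>
    intro T g
    cases g with
    | hole h hE =>
      have hl := hF _ _ h₁
      obtain ⟨Γ', T', h', ht⟩ := S.typed _ _ hl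
      rw [h] at h'
      cases h'
      obtain ⟨g, s⟩ := S.eval_good h₃ hE ht (S.code hl)
      exact ⟨(ih g).1, .root (.hole hl h₂) (s.trans (ih g).2)⟩
  | holeIndet _ _ ih =>
    intro T g
    cases g with
    | hole h hE => exact ⟨.hole h (ih hE).1, .susp (ih hE).2⟩
  | fix _ ih =>
    intro T g
    cases g with
    | fix hE ht hP => exact ⟨.fix (ih hE).1 ht hP, .susp (ih hE).2⟩
  | unit => intro T g; exact ⟨g, .refl⟩
  | pair _ _ ih₁ ih₂ =>
    intro T g
    cases g with
    | pair g₁ g₂ => exact ⟨.pair (ih₁ g₁).1 (ih₂ g₂).1, .pair (ih₁ g₁).2 (ih₂ g₂).2⟩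
  | ctor _ ih =>
    intro T g
    cases g with
    | ctor hC g => exact ⟨.ctor hC (ih g).1, .ctor (ih g).2⟩
  | app _ _ h₃ _ ih₁ ih₂ ih₃ =>
    intro T g
    cases g with
    | app g₁ g₂ =>
      obtain ⟨g₁, s₁⟩ := ih₁ g₁
      obtain ⟨g₂, s₂⟩ := ih₂ g₂
      cases g₁ with
      | fix hE ht hP =>
        cases ht with
        | fix ht₀ =>
          obtain ⟨g, s⟩ := S.eval_good h₃ (.cons (.cons hE (.fix hE (.fix ht₀) hP)) g₂) ht₀
            (S.sub .fix hP)
          exact ⟨(ih₃ g).1, (Steps.app s₁ s₂).trans (Steps.root .beta (s.trans (ih₃ g).2))⟩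
  | appIndet _ _ _ ih₁ ih₂ =>
    intro T g
    cases g with
    | app g₁ g₂ => exact ⟨.app (ih₁ g₁).1 (ih₂ g₂).1, .app (ih₁ g₁).2 (ih₂ g₂).2⟩
  | prj _ ih =>
    intro T g
    cases g with
    | prj g =>
      obtain ⟨g, s⟩ := ih g
      cases g with
      | pair g₁ g₂ =>
        refine ⟨g₁.pick g₂, (Steps.prj s).trans (Steps.root .proj ?_)⟩
        rw [Result.toTh_pick]
  | prjIndet _ _ ih =>
    intro T g
    cases g with
    | prj g => exact ⟨.prj (ih g).1, .prj (ih g).2⟩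
  | caseOf hm _ _ _ h₅ _ ih₁ ih₂ ih₃ ih₄ =>
    intro T g
    cases g with
    | caseOf g hD hE ha hb hP =>
      obtain ⟨g₁, s₁⟩ := ih₁ g
      obtain ⟨gE, sE⟩ := ih₂ hE
      cases g₁ with
      | ctor hC g' =>
        obtain ⟨g₂, s₂⟩ := ih₃ g'
        obtain ⟨g₃, s₃⟩ := S.eval_good h₅ (.cons gE g₂)
          (hb _ _ _ _ (S.wf.mem_of_hasCtor hC hD) hm) (S.sub (.arm hm) hP)
        exact ⟨(ih₄ g₃).1, (Steps.caseOf sE (s₁.trans (Steps.ctor s₂))).trans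
          (Steps.root (.branch hm (S.wf.arm_unique hD ha hm)) (s₃.trans (ih₄ g₃).2))⟩
  | caseIndet _ _ _ ih₁ ih₂ =>
    intro T g
    cases g with
    | caseOf g hD hE ha hb hP =>
      exact ⟨.caseOf (ih₁ g).1 hD (ih₂ hE).1 ha hb hP, .caseOf (ih₂ hE).2 (ih₁ g).2⟩
  | unwrap _ ih =>
    intro T g
    cases g with
    | unwrap hC g _ _ _ =>
      obtain ⟨g, s⟩ := ih g
      cases g with
      | ctor hC' g =>
        obtain rfl := S.wf.ctor_unique hC hC'
        exact ⟨g, (Steps.unwrap s).trans (Steps.root .unwrap .refl)⟩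
  | unwrapIndet h₁ h₂ ih =>
    intro T g
    have g' := g
    cases g with
    | unwrap hC g _ _ _ =>
      exact ⟨hU g' h₁ h₂ (fun _ g => (ih g).1) (ih g).2, .unwrap (ih g).2⟩
  | nil => rename_i g; exact ⟨g, .refl⟩
  | cons _ _ ih₁ ih₂ =>
    rename_i g
    cases g with
    | cons gE g => exact ⟨.cons (ih₁ gE).1 (ih₂ g).1, .cons (ih₂ g).2 (ih₁ gE).2⟩

end

/-- Resumed results are normal forms. -/
theorem Resume.nf {F : Filling} {r r'} (h : Resume F r r') : Nf F r'.toTh := by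
  induction h using Resume.rec (motive_2 := fun E E' _ => Nf F (envTh E')) with
  | holeResume _ _ _ _ ih => exact ih
  | holeIndet h _ ih => exact .hole ih h
  | fix _ ih => exact .fix ih
  | unit => exact .unit
  | pair _ _ ih₁ ih₂ => exact .pair ih₁ ih₂
  | ctor _ ih => exact .ctor ih
  | app _ _ _ _ _ _ ih => exact ih
  | @appIndet _ _ r _ _ _ h ih₁ ih₂ =>
    refine .app ih₁ ih₂ fun E f x e he => ?_
    cases r <;> simp_all [Result.toTh]
  | @prj i _ _ _ _ ih => cases ih; cases i <;> assumption
  | @prjIndet _ _ r _ h ih =>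
    refine .prj ih fun b c he => ?_
    cases r <;> simp_all [Result.toTh]
  | caseOf _ _ _ _ _ _ _ _ _ ih => exact ih
  | @caseIndet _ _ _ r _ _ h _ ih₁ ih₂ =>
    refine .caseOf ih₂ ih₁ fun C x e b hm he => ?_
    cases r <;> simp [Result.toTh] at he
    obtain ⟨rfl, -⟩ := he
    exact h _ _ _ _ hm rfl
  | unwrap _ ih => cases ih; assumption
  | @unwrapIndet _ _ r _ h ih =>
    refine .unwrap ih fun C b he => ?_
    cases r <;> simp_all [Result.toTh]
  | nil => exact .nil
  | cons _ _ ih₁ ih₂ => exact .cons ih₂ ih₁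

/-- Resumed results resume to themselves. -/
theorem Resume.self {F : Filling} {r r'} (h : Resume F r r') : Resume F r' r' := by
  induction h using Resume.rec (motive_2 := fun E E' _ => ResumeEnv F E' E') with
  | holeResume _ _ _ _ ih => exact ih
  | holeIndet h _ ih => exact .holeIndet h ih
  | fix _ ih => exact .fix ih
  | unit => exact .unit
  | pair _ _ ih₁ ih₂ => exact .pair ih₁ ih₂
  | ctor _ ih => exact .ctor ih
  | app _ _ _ _ _ _ ih => exact ih
  | appIndet _ _ h ih₁ ih₂ => exact .appIndet ih₁ ih₂ h
  | @prj i _ _ _ _ ih => cases ih; cases i <;> assumption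
  | prjIndet _ h ih => exact .prjIndet ih h
  | caseOf _ _ _ _ _ _ _ _ _ ih => exact ih
  | caseIndet _ h _ ih₁ ih₂ => exact .caseIndet ih₁ h ih₂
  | unwrap _ ih => cases ih; assumption
  | unwrapIndet _ h ih => exact .unwrapIndet ih h
  | nil => exact .nil
  | cons _ _ ih₁ ih₂ => exact .cons ih₁ ih₂

section

variable {Sg : DataCtx} {Δ : HoleCtx} {F : Filling} {P : Set Exp}

theorem TotalOn.resume_self_good (S : TotalOn Sg Δ F P) {r r' T} (h : Resume F r r')
    (g : Good Sg Δ F P r T) : Good Sg Δ F P r' T ∧ Steps F r.toTh r'.toTh := by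
  refine S.resume_good_of_unwrap (fun _ _ h => h) (fun {C r r' T} g h hn _ s => ?_) h g
  cases g with
  | unwrap _ _ h₁ h₂ _ =>
    have e : r'.toTh = (Result.ctor C _).toTh :=
      Conv.eq_of_nf ((Conv.ofSteps s).symm.trans (.ofSteps h₂)) h.nf h₁.nf
    exact absurd (Result.toTh_inj _ _ e) (hn _ _)

theorem TotalOn.resume_unique (S : TotalOn Sg Δ F P) {r r₁ r₂ T} (g : Good Sg Δ F P r T)
    (h₁ : Resume F r r₁) (h₂ : Resume F r r₂) : r₁ = r₂ :=
  Result.toTh_inj _ _ <| Conv.eq_of_nf ((Conv.ofSteps (S.resume_self_good h₁ g).2).symm.trans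
    (.ofSteps (S.resume_self_good h₂ g).2)) h₁.nf h₂.nf

end

/-! ## Elimination of inverse constructor applications -/

mutual

/-- `Hat F r r'`: the result `r'` arises from `r` by replacing inverse constructor applications by
projections from a pair that contains the result of resuming them. -/
inductive Hat (F : Filling) : Result → Result → Prop
  | fix {E E' f x e} : HatEnv F E E' → Hat F (.fix E f x e) (.fix E' f x e)
  | hole {E E' h} : HatEnv F E E' → Hat F (.hole E h) (.hole E' h)
  | unit : Hat F .unit .unit
  | pair {r₁ r₂ r₁' r₂'} : Hat F r₁ r₁' → Hat F r₂ r₂' → Hat F (.pair r₁ r₂) (.pair r₁' r₂')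
  | ctor {C r r'} : Hat F r r' → Hat F (.ctor C r) (.ctor C r')
  | app {r₁ r₂ r₁' r₂'} : Hat F r₁ r₁' → Hat F r₂ r₂' → Hat F (.app r₁ r₂) (.app r₁' r₂')
  | prj {i r r'} : Hat F r r' → Hat F (.prj i r) (.prj i r')
  | caseOf {E E' r r' arms} : HatEnv F E E' → Hat F r r' →
      Hat F (.caseOf E r arms) (.caseOf E' r' arms)
  | unwrap {C r r' r''} : Resume F r (.ctor C r') → (∀ s, Resume F r' s → s = r') → Hat F r' r'' →
      Hat F (.unwrap C r) (.prj .fst (.pair r'' .unit))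

/-- `Hat` for environments. -/
inductive HatEnv (F : Filling) : Env → Env → Prop
  | nil : HatEnv F [] []
  | cons {E E' x r r'} : HatEnv F E E' → Hat F r r' → HatEnv F ((x, r) :: E) ((x, r') :: E')

end

section

variable {Sg : DataCtx} {Δ : HoleCtx} {F : Filling} {P : Set Exp}

theorem TotalOn.exists_hat (S : TotalOn Sg Δ F P) {r T} (g : Good Sg Δ F P r T) :
    ∃ r', Hat F r r' ∧ ResultTyped Sg Δ r' T ∧ CodeIn P r' := by
  induction g using Good.rec (motive_2 := fun E Γ _ => ∃ E', HatEnv F E E' ∧ EnvTyped Sg Δ E' Γ ∧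
    EnvCodeIn P E') with
  | fix _ ht hP ih =>
    obtain ⟨E', h₁, h₂, h₃⟩ := ih
    exact ⟨_, .fix h₁, .fix h₂ ht, .fix h₃ hP⟩
  | hole hΔ _ ih =>
    obtain ⟨E', h₁, h₂, h₃⟩ := ih
    exact ⟨_, .hole h₁, .hole hΔ h₂, .hole h₃⟩
  | unit => exact ⟨_, .unit, .unit, .unit⟩
  | pair _ _ ih₁ ih₂ =>
    obtain ⟨_, h₁, h₂, h₃⟩ := ih₁
    obtain ⟨_, k₁, k₂, k₃⟩ := ih₂
    exact ⟨_, .pair h₁ k₁, .pair h₂ k₂, .pair h₃ k₃⟩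
  | ctor hC _ ih =>
    obtain ⟨_, h₁, h₂, h₃⟩ := ih
    exact ⟨_, .ctor h₁, .ctor hC h₂, .ctor h₃⟩
  | app _ _ ih₁ ih₂ =>
    obtain ⟨_, h₁, h₂, h₃⟩ := ih₁
    obtain ⟨_, k₁, k₂, k₃⟩ := ih₂
    exact ⟨_, .app h₁ k₁, .app h₂ k₂, .app h₃ k₃⟩
  | prj _ ih =>
    obtain ⟨_, h₁, h₂, h₃⟩ := ih
    exact ⟨_, .prj h₁, .prj h₂, .prj h₃⟩
  | caseOf _ hD _ ha hb hP ih₁ ih₂ =>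
    obtain ⟨_, h₁, h₂, h₃⟩ := ih₁
    obtain ⟨_, k₁, k₂, k₃⟩ := ih₂
    exact ⟨_, .caseOf k₁ h₁, .caseOf h₂ hD k₂ ha hb, .caseOf k₃ h₃ hP⟩
  | unwrap hC _ hr _ g _ ih =>
    obtain ⟨_, h₁, h₂, h₃⟩ := ih
    have hs := hr.self
    cases hs with
    | ctor hs =>
      exact ⟨_, .unwrap hr (fun s h => S.resume_unique g h hs) h₁,
        .prj (T₂ := .unit) (.pair h₂ .unit), .prj (.pair h₃ .unit)⟩
  | nil => exact ⟨_, .nil, .nil, .nil⟩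
  | cons _ _ ih₁ ih₂ =>
    obtain ⟨_, h₁, h₂, h₃⟩ := ih₁
    obtain ⟨_, k₁, k₂, k₃⟩ := ih₂
    exact ⟨_, .cons h₁ k₁, .cons h₂ k₂, .cons h₃ k₃⟩

theorem HatEnv.lookup {x r'} : ∀ {E E'}, HatEnv F E E' → List.lookup x E' = some r' →
    ∃ r, List.lookup x E = some r ∧ Hat F r r'
  | _, _, .nil, h => by simp at h
  | _, _, .cons (x := y) hE hr, h => by
    rw [List.lookup_cons] at h ⊢
    split at h
    · simp_all
    · simp_all
      exact hE.lookup h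

theorem Hat.pick {i : Side} {r₁ r₂ r₁' r₂'} (h₁ : Hat F r₁ r₁') (h₂ : Hat F r₂ r₂') :
    Hat F (i.pick r₁ r₂) (i.pick r₁' r₂') := by
  cases i <;> assumption

theorem Hat.eval {E' e r'} (h : Eval E' e r') : ∀ {E}, HatEnv F E E' →
    ∃ r, Eval E e r ∧ Hat F r r' := by
  induction h with
  | fix => exact fun hE => ⟨_, .fix, .fix hE⟩
  | var h =>
    intro E hE
    obtain ⟨r, h₁, h₂⟩ := hE.lookup h
    exact ⟨r, .var h₁, h₂⟩
  | hole => exact fun hE => ⟨_, .hole, .hole hE⟩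
  | unit => exact fun hE => ⟨_, .unit, .unit⟩
  | pair _ _ ih₁ ih₂ =>
    intro E hE
    obtain ⟨_, h₁, k₁⟩ := ih₁ hE
    obtain ⟨_, h₂, k₂⟩ := ih₂ hE
    exact ⟨_, .pair h₁ h₂, .pair k₁ k₂⟩
  | ctor _ ih =>
    intro E hE
    obtain ⟨_, h₁, k₁⟩ := ih hE
    exact ⟨_, .ctor h₁, .ctor k₁⟩
  | app _ _ _ ih₁ ih₂ ih₃ =>
    intro E hE
    obtain ⟨_, h₁, k₁⟩ := ih₁ hE
    obtain ⟨_, h₂, k₂⟩ := ih₂ hE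
    cases k₁ with
    | fix hE' =>
      obtain ⟨_, h₃, k₃⟩ := ih₃ (.cons (.cons hE' (.fix hE')) k₂)
      exact ⟨_, .app h₁ h₂ h₃, k₃⟩
  | appIndet _ _ hn ih₁ ih₂ =>
    intro E hE
    obtain ⟨_, h₁, k₁⟩ := ih₁ hE
    obtain ⟨_, h₂, k₂⟩ := ih₂ hE
    refine ⟨_, .appIndet h₁ h₂ ?_, .app k₁ k₂⟩
    rintro _ _ _ _ rfl
    cases k₁
    exact hn _ _ _ _ rfl
  | prj _ ih =>
    intro E hE
    obtain ⟨_, h₁, k₁⟩ := ih hE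
    cases k₁ with
    | pair k₁ k₂ => exact ⟨_, .prj h₁, k₁.pick k₂⟩
  | prjIndet _ hn ih =>
    intro E hE
    obtain ⟨_, h₁, k₁⟩ := ih hE
    refine ⟨_, .prjIndet h₁ ?_, .prj k₁⟩
    rintro _ _ rfl
    cases k₁
    exact hn _ _ rfl
  | caseOf hm _ _ ih₁ ih₂ =>
    intro E hE
    obtain ⟨_, h₁, k₁⟩ := ih₁ hE
    cases k₁ with
    | ctor k₁ =>
      obtain ⟨_, h₂, k₂⟩ := ih₂ (.cons hE k₁)
      exact ⟨_, .caseOf hm h₁ h₂, k₂⟩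
  | caseIndet _ hn ih =>
    intro E hE
    obtain ⟨_, h₁, k₁⟩ := ih hE
    refine ⟨_, .caseIndet h₁ ?_, .caseOf hE k₁⟩
    rintro _ _ _ _ hm rfl
    cases k₁
    exact hn _ _ _ _ hm rfl

theorem Hat.resume {r' s} (h : Resume F r' s) : ∀ {r}, Hat F r r' → Resume F r s := by
  induction h using Resume.rec (motive_2 := fun E' E'' _ => ∀ {E}, HatEnv F E E' →
    ResumeEnv F E E'') with
  | holeResume h₁ h₂ h₃ _ ih =>
    intro r k
    cases k with
    | hole kE =>
      obtain ⟨_, h₄, k⟩ := Hat.eval h₃ kE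
      exact .holeResume h₁ h₂ h₄ (ih k)
  | holeIndet h _ ih => intro r k; cases k with | hole kE => exact .holeIndet h (ih kE)
  | fix _ ih => intro r k; cases k with | fix kE => exact .fix (ih kE)
  | unit => intro r k; cases k; exact .unit
  | pair _ _ ih₁ ih₂ => intro r k; cases k with | pair k₁ k₂ => exact .pair (ih₁ k₁) (ih₂ k₂)
  | ctor _ ih => intro r k; cases k with | ctor k => exact .ctor (ih k)
  | app _ _ h₃ h₄ ih₁ ih₂ _ =>
    intro r k
    cases k with | app k₁ k₂ => exact .app (ih₁ k₁) (ih₂ k₂) h₃ h₄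
  | appIndet _ _ hn ih₁ ih₂ =>
    intro r k
    cases k with | app k₁ k₂ => exact .appIndet (ih₁ k₁) (ih₂ k₂) hn
  | prj h ih =>
    intro r k
    cases k with
    | prj k => exact .prj (ih k)
    | unwrap h₁ h₂ k =>
      have := ih (.pair k .unit)
      cases this with
      | pair h₃ _ =>
        obtain rfl := h₂ _ h₃
        exact .unwrap h₁
  | prjIndet h hn ih =>
    intro r k
    cases k with
    | prj k => exact .prjIndet (ih k) hn
    | unwrap => cases h; exact absurd rfl (hn _ _)
  | caseOf hm _ _ h₃ h₄ h₅ ih₁ ih₂ _ _ =>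
    intro r k
    cases k with | caseOf kE k => exact .caseOf hm (ih₁ k) (ih₂ kE) h₃ h₄ h₅
  | caseIndet _ hn _ ih₁ ih₂ =>
    intro r k
    cases k with | caseOf kE k => exact .caseIndet (ih₁ k) hn (ih₂ kE)
  | unwrap => intro r k; cases k
  | unwrapIndet => intro r k; cases k
  | nil => rename_i k; cases k; exact .nil
  | cons _ _ ih₁ ih₂ => rename_i k; cases k with | cons kE k => exact .cons (ih₁ kE) (ih₂ k)

/-- Good results resume. -/
theorem TotalOn.exists_resume (S : TotalOn Sg Δ F P) {r T} (g : Good Sg Δ F P r T) :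
    ∃ s, Resume F r s := by
  obtain ⟨r', h₁, h₂, h₃⟩ := S.exists_hat g
  obtain ⟨s, hs⟩ := S.resume h₃ h₂
  exact ⟨s, Hat.resume hs h₁⟩

theorem TotalOn.resume_of_conv (S : TotalOn Sg Δ F P) {r r₁ s T T₁} (g : Good Sg Δ F P r T)
    (g₁ : Good Sg Δ F P r₁ T₁) (h : Conv F r.toTh r₁.toTh) (hs : Resume F r₁ s) :
    Resume F r s := by
  obtain ⟨s', hs'⟩ := S.exists_resume g
  have : s'.toTh = s.toTh := Conv.eq_of_nf
    ((Conv.ofSteps (S.resume_self_good hs' g).2).symm.trans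
      (h.trans (.ofSteps (S.resume_self_good hs g₁).2))) hs'.nf hs.nf
  rwa [← Result.toTh_inj _ _ this]

/-- Inverse constructor applications are good if their argument resumes to that constructor. -/
theorem TotalOn.good_unwrap (S : TotalOn Sg Δ F P) {C r r' T D} (hC : Sg.HasCtor C T D)
    (g : Good Sg Δ F P r (.data D)) (h : Resume F r (.ctor C r')) :
    Good Sg Δ F P (.unwrap C r) T := by
  obtain ⟨g', s⟩ := S.resume_self_good h g
  cases g' with
  | ctor hC' g' =>
    obtain rfl := S.wf.ctor_unique hC hC'
    exact .unwrap hC g h s g'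

/-- Resumption under smaller fillings preserves goodness and is contained in reduction. -/
theorem TotalOn.resume_good (S : TotalOn Sg Δ F P) {F₀ r r' T} (hF : Extends F F₀)
    (h : Resume F₀ r r') (g : Good Sg Δ F P r T) :
    Good Sg Δ F P r' T ∧ Steps F r.toTh r'.toTh := by
  refine S.resume_good_of_unwrap hF (fun {C r r' T} g h hn hg s => ?_) h g
  cases g with
  | unwrap hC g h₁ _ _ =>
    exact S.good_unwrap hC (hg _ g) (S.resume_of_conv (hg _ g) g (Conv.ofSteps s).symm h₁)

/-- Live evaluation under smaller fillings preserves goodness and is contained in reduction. -/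
theorem TotalOn.liveEval_good (S : TotalOn Sg Δ F P) {F₀ E e r Γ T} (hF : Extends F F₀)
    (h : LiveEval E F₀ e r) (hE : GoodEnv Sg Δ F P E Γ) (ht : HasType Sg Δ Γ e T) (hP : e ∈ P) :
    Good Sg Δ F P r T ∧ Steps F (.susp (envTh E) e) r.toTh := by
  obtain ⟨r₀, h₁, h₂⟩ := h
  obtain ⟨g₀, s₀⟩ := S.eval_good h₁ hE ht hP
  obtain ⟨g, s⟩ := S.resume_good hF h₂ g₀
  exact ⟨g, s₀.trans s⟩

end

/-- Each branch of a well-typed case expression belongs to a declared constructor. -/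
theorem exists_ctor_of_arm {cs : List (Ctor × Ty)} {arms : List (Ctor × Var × Exp)}
    (ha : arms.map Prod.fst = cs.map Prod.fst) {C x e} (h : (C, x, e) ∈ arms) :
    ∃ T, (C, T) ∈ cs := by
  have : C ∈ cs.map Prod.fst := ha ▸ List.mem_map_of_mem (f := Prod.fst) h
  simpa using this

/-! ## Merging -/

theorem MergeF.lookup {F₁ F₂ F : Filling} (h : MergeF F₁ F₂ F) {n e}
    (he : F.lookup n = some e) : F₁.lookup n = some e ∨ F₂.lookup n = some e := by
  rw [h.2] at he
  rcases Finmap.mem_lookup_union.1 he with h | h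
  · exact .inl h
  · exact .inr h.2

theorem MergeF.extends_left {F₁ F₂ F : Filling} (h : MergeF F₁ F₂ F) : Extends F F₁ := by
  intro n e he
  rw [h.2]
  exact Finmap.mem_lookup_union.2 (.inl he)

theorem MergeF.extends_right {F₁ F₂ F : Filling} (h : MergeF F₁ F₂ F) : Extends F F₂ := by
  intro n e he
  rw [h.2]
  by_cases hn : n ∈ F₁
  · obtain ⟨e', he'⟩ := Finmap.mem_iff.1 hn
    rw [Finmap.lookup_union_left hn, he', h.1 _ _ _ he' he]
  · rw [Finmap.lookup_union_right hn, he]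

theorem Extends.trans {F₁ F₂ F₃ : Filling} (h₁ : Extends F₁ F₂) (h₂ : Extends F₂ F₃) :
    Extends F₁ F₃ := fun n e h => h₁ n e (h₂ n e h)

theorem MergeF.extends {F₁ F₂ F₃ F : Filling} (h : MergeF F₁ F₂ F₃) (h₁ : Extends F F₁)
    (h₂ : Extends F F₂) : Extends F F₃ := fun n e he => (h.lookup he).elim (h₁ n e) (h₂ n e)

/-- The worlds of unfilled-hole constraints, each with its hole. -/
def worldsOf (U : Unfilled) : Set (Hole × World) := {w | ∃ X, U.lookup w.1 = some X ∧ w.2 ∈ X}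

theorem worldsOf_empty : worldsOf ∅ = ∅ := by
  ext w
  simp [worldsOf]

theorem mem_worldsOf_singleton {h : Hole} {X : Worlds} {w} :
    w ∈ worldsOf (Finmap.singleton (β := fun _ => Worlds) h X) ↔ w.1 = h ∧ w.2 ∈ X := by
  obtain ⟨n, w⟩ := w
  by_cases hn : n = h
  · subst hn
    simp [worldsOf]
  · have : (Finmap.singleton (β := fun _ => Worlds) h X).lookup n = none := by
      rw [Finmap.lookup_eq_none, Finmap.mem_singleton]; exact hn
    simp [worldsOf, this, hn]

theorem MergeU.worldsOf_eq {U₁ U₂ U : Unfilled} (h : MergeU U₁ U₂ U) :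
    worldsOf U = worldsOf U₁ ∪ worldsOf U₂ := by
  ext w
  simp only [worldsOf, Set.mem_ofPred_eq, Set.mem_union, h w.1]
  rcases U₁.lookup w.1 with _ | X <;> rcases U₂.lookup w.1 with _ | Y <;> simp [unionWorlds]

theorem MergeList.worldsOf_eq {Ks K} (h : MergeList Ks K) :
    worldsOf K.U = {w | ∃ K' ∈ Ks, w ∈ worldsOf K'.U} := by
  induction h with
  | nil => simp [Constraints.empty, worldsOf_empty]
  | cons _ h ih =>
    ext w
    simp [h.2.worldsOf_eq, ih]

theorem MergeList.extends {Ks K} (h : MergeList Ks K) {F : Filling} (hF : Extends F K.F) :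
    ∀ K' ∈ Ks, Extends F K'.F := by
  induction h with
  | nil => simp
  | cons _ h ih =>
    simp only [List.mem_cons, forall_eq_or_imp]
    exact ⟨hF.trans h.1.extends_left, ih (hF.trans h.1.extends_right)⟩

theorem MergeList.lookup {Ks K} (h : MergeList Ks K) {n e} (he : K.F.lookup n = some e) :
    ∃ K' ∈ Ks, K'.F.lookup n = some e := by
  induction h with
  | nil => simp [Constraints.empty] at he
  | cons _ h ih =>
    rcases h.1.lookup he with h | h
    · exact ⟨_, by simp, h⟩
    · obtain ⟨K', h₁, h₂⟩ := ih h
      exact ⟨K', by simp [h₁], h₂⟩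

/-! ## Justified worlds -/

/-- Example typing with good values. -/
inductive GoodEx (Sg : DataCtx) (Δ : HoleCtx) (F : Filling) (P : Set Exp) : Ex → Ty → Prop
  | unit : GoodEx Sg Δ F P .unit .unit
  | pair {ex₁ ex₂ T₁ T₂} : GoodEx Sg Δ F P ex₁ T₁ → GoodEx Sg Δ F P ex₂ T₂ →
      GoodEx Sg Δ F P (.pair ex₁ ex₂) (.pair T₁ T₂)
  | ctor {C ex T D} : Sg.HasCtor C T D → GoodEx Sg Δ F P ex T →
      GoodEx Sg Δ F P (.ctor C ex) (.data D)
  | io {v ex T₁ T₂} : Good Sg Δ F P v.toResult T₁ → GoodEx Sg Δ F P ex T₂ →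
      GoodEx Sg Δ F P (.io v ex) (.arrow T₁ T₂)
  | top {T} : GoodEx Sg Δ F P .top T

/-- The environment and the example of a world have the types required by its hole. -/
def GoodWorld (Sg : DataCtx) (Δ : HoleCtx) (F : Filling) (P : Set Exp) (w : Hole × World) : Prop :=
  ∃ Γ T, Δ.lookup w.1 = some (Γ, T) ∧ GoodEnv Sg Δ F P w.2.1 Γ ∧ GoodEx Sg Δ F P w.2.2 T

/-- The filling satisfies the example of a world at its hole. -/
def SatWorld (F : Filling) (w : Hole × World) : Prop :=
  ∃ s, Resume F (.hole w.2.1 w.1) s ∧ ExSat F s w.2.2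

/-- All worlds of a set are satisfied. -/
def AllSat (F : Filling) (A : Set (Hole × World)) : Prop := ∀ w ∈ A, SatWorld F w

/-- `A` contains each world of `W` that is good as soon as `A` is satisfied. -/
def ClosedIn (Sg : DataCtx) (Δ : HoleCtx) (F : Filling) (P : Set Exp) (W A : Set (Hole × World)) :
    Prop :=
  ∀ w ∈ W, (AllSat F A → GoodWorld Sg Δ F P w) → w ∈ A

/-- The worlds of `W` can be ordered so that each is good if its predecessors are satisfied. -/
def Justified (Sg : DataCtx) (Δ : HoleCtx) (F : Filling) (P : Set Exp) (W : Set (Hole × World)) :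
    Prop :=
  ∀ A, ClosedIn Sg Δ F P W A → W ⊆ A

/-- The constraints `U` replace the worlds `X` of the hole `h`: each world of `X` gives rise to some
worlds of `U`, which are justified and imply that it is satisfied. -/
def Handles (Sg : DataCtx) (Δ : HoleCtx) (F : Filling) (P : Set Exp) (h : Hole) (X : Worlds)
    (U : Unfilled) : Prop :=
  ∃ O : World → Set (Hole × World), (∀ o ∈ worldsOf U, ∃ w ∈ X, o ∈ O w) ∧
    ∀ W A, worldsOf U ⊆ W → ClosedIn Sg Δ F P W A → ∀ w ∈ X,
      (AllSat F A → GoodWorld Sg Δ F P (h, w)) → O w ⊆ A ∧ (AllSat F A → SatWorld F (h, w))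

section

variable {Sg : DataCtx} {Δ : HoleCtx} {F : Filling} {P : Set Exp}

theorem handles_singleton {h : Hole} {X : Worlds} :
    Handles Sg Δ F P h X (Finmap.singleton h X) := by
  refine ⟨fun w => {(h, w)}, ?_, ?_⟩
  · rintro ⟨n, w⟩ ho
    obtain ⟨rfl, hw⟩ := mem_worldsOf_singleton.1 ho
    exact ⟨w, hw, rfl⟩
  · intro W A hW hA w hw hg
    have : (h, w) ∈ A := hA _ (hW (mem_worldsOf_singleton.2 ⟨rfl, hw⟩)) hg
    exact ⟨by simpa using this, fun hs => hs _ this⟩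

/-- If each hole's worlds are handled by some of the worlds of `U'`, and these make up `U'`, then
justification is passed on to `U'`, and satisfaction back from it. -/
theorem Justified.transfer {U U' : Unfilled} (V : Hole → Unfilled)
    (hV : ∀ h X, U.lookup h = some X → Handles Sg Δ F P h X (V h) ∧ worldsOf (V h) ⊆ worldsOf U')
    (hU' : ∀ o ∈ worldsOf U', ∃ h X, U.lookup h = some X ∧ o ∈ worldsOf (V h))
    (hU : Justified Sg Δ F P (worldsOf U)) :
    Justified Sg Δ F P (worldsOf U') ∧
      (AllSat F (worldsOf U') → AllSat F (worldsOf U)) := by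
  have key : ∀ A, ClosedIn Sg Δ F P (worldsOf U') A →
      worldsOf U' ⊆ A ∧ (AllSat F A → AllSat F (worldsOf U)) := by
    intro A hA
    choose! O hO₁ hO₂ using fun h X hX => (hV h X hX).1
    have hsub := hU {w | ∃ X, U.lookup w.1 = some X ∧ O w.1 X w.2 ⊆ A ∧ (AllSat F A → SatWorld F w)}
      (by
        rintro ⟨h, w⟩ ⟨X, hX, hw⟩ hg
        refine ⟨X, hX, hO₂ h X hX _ A (hV h X hX).2 hA w hw fun hs => hg ?_⟩
        rintro w' ⟨X', -, -, hs'⟩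
        exact hs' hs)
    refine ⟨fun o ho => ?_, fun hs w hw => ?_⟩
    · obtain ⟨h, X, hX, ho⟩ := hU' o ho
      obtain ⟨w, hw, how⟩ := hO₁ h X hX o ho
      obtain ⟨X', hX', hA', -⟩ := hsub (show (h, w) ∈ worldsOf U from ⟨X, hX, hw⟩)
      obtain rfl : X = X' := Option.some.inj (hX.symm.trans hX')
      exact hA' how
    · obtain ⟨_, -, -, h⟩ := hsub hw
      exact h hs
  exact ⟨fun A hA => (key A hA).1, (key (worldsOf U') fun _ h _ => h).2⟩

theorem TotalOn.satWorld_of_conv (S : TotalOn Sg Δ F P) {h E ex e r s T}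
    (hg : GoodWorld Sg Δ F P (h, E, ex)) (he : F.lookup h = some e) (g : Good Sg Δ F P r T)
    (hc : Conv F (.susp (envTh E) e) r.toTh) (hs : Resume F r s) (hx : ExSat F s ex) :
    SatWorld F (h, E, ex) := by
  obtain ⟨Γ, T', hΔ, gE, -⟩ := hg
  exact ⟨s, S.resume_of_conv (.hole hΔ gE) g ((Conv.ofSteps (.fill he)).trans hc) hs, hx⟩

theorem TotalOn.satWorld_top (S : TotalOn Sg Δ F P) {h E} (hg : GoodWorld Sg Δ F P (h, E, .top)) :
    SatWorld F (h, E, .top) := by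
  obtain ⟨Γ, T', hΔ, gE, -⟩ := hg
  obtain ⟨s, hs⟩ := S.exists_resume (.hole hΔ gE)
  exact ⟨s, hs, .top⟩

theorem GoodWorld.type_of_lookup (S : TotalOn Sg Δ F P) {h : Hole} {w : World} {e}
    (hg : GoodWorld Sg Δ F P (h, w)) (he : F.lookup h = some e) :
    ∃ Γ T, GoodEnv Sg Δ F P w.1 Γ ∧ HasType Sg Δ Γ e T ∧ GoodEx Sg Δ F P w.2 T := by
  obtain ⟨Γ, T, hΔ, gE, gx⟩ := hg
  obtain ⟨Γ', T', hΔ', ht⟩ := S.typed _ _ he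
  cases hΔ.symm.trans hΔ'
  exact ⟨Γ, T, gE, ht, gx⟩

theorem Downcast.eq {r v} (h : Downcast r v) : r = v.toResult := by
  induction h with
  | unit => rfl
  | pair _ _ ih₁ ih₂ => rw [ih₁, ih₂]; rfl
  | ctor _ ih => rw [ih]; rfl

/-! ## Soundness of live unevaluation and example checking -/

theorem TotalOn.uneval_sound (S : TotalOn Sg Δ F P) {W A : Set (Hole × World)}
    (hA : ClosedIn Sg Δ F P W A) {Gs : GuessFn} {Δ₀ F₀ r ex K} (h : Uneval Gs Sg Δ₀ F₀ r ex K) :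
    Extends F F₀ → Extends F K.F → worldsOf K.U ⊆ W →
      (AllSat F A → ∃ T, Good Sg Δ F P r T ∧ GoodEx Sg Δ F P ex T) →
      worldsOf K.U ⊆ A ∧ (AllSat F A → ∃ s, Resume F r s ∧ ExSat F s ex) := by
  induction h with
  | top =>
    intro hF hK hW hg
    refine ⟨by simp [Constraints.empty, worldsOf_empty], fun hs => ?_⟩
    obtain ⟨T, g, -⟩ := hg hs
    obtain ⟨s, h⟩ := S.exists_resume g
    exact ⟨s, h, .top⟩
  | unit =>
    intro hF hK hW hg
    exact ⟨by simp [Constraints.empty, worldsOf_empty], fun _ => ⟨_, .unit, .unit⟩⟩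
  | pair _ _ hM ih₁ ih₂ =>
    intro hF hK hW hg
    rw [hM.2.worldsOf_eq] at hW ⊢
    obtain ⟨h₁, k₁⟩ := ih₁ hF (hK.trans hM.1.extends_left) (fun _ h => hW (.inl h)) fun hs => by
      obtain ⟨_, g, gx⟩ := hg hs
      cases g with | pair g₁ _ => cases gx with | pair x₁ _ => exact ⟨_, g₁, x₁⟩
    obtain ⟨h₂, k₂⟩ := ih₂ hF (hK.trans hM.1.extends_right) (fun _ h => hW (.inr h)) fun hs => by
      obtain ⟨_, g, gx⟩ := hg hs
      cases g with | pair _ g₂ => cases gx with | pair _ x₂ => exact ⟨_, g₂, x₂⟩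
    refine ⟨Set.union_subset h₁ h₂, fun hs => ?_⟩
    obtain ⟨_, a₁, b₁⟩ := k₁ hs
    obtain ⟨_, a₂, b₂⟩ := k₂ hs
    exact ⟨_, .pair a₁ a₂, .pair b₁ b₂⟩
  | ctor _ ih =>
    intro hF hK hW hg
    obtain ⟨h, k⟩ := ih hF hK hW fun hs => by
      obtain ⟨_, g, gx⟩ := hg hs
      cases g with
      | ctor hC g =>
        cases gx with
        | ctor hC' x =>
          obtain rfl := S.wf.ctor_unique hC hC'
          exact ⟨_, g, x⟩
    refine ⟨h, fun hs => ?_⟩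
    obtain ⟨_, a, b⟩ := k hs
    exact ⟨_, .ctor a, .ctor b⟩
  | @fix F₀ E f x e v ex r K hl _ ih =>
    intro hF hK hW hg
    have hg' : AllSat F A → ∃ T₁ T₂, Good Sg Δ F P (.fix E f x e) (.arrow T₁ T₂) ∧
        Good Sg Δ F P v.toResult T₁ ∧ GoodEx Sg Δ F P ex T₂ ∧ Good Sg Δ F P r T₂ ∧
        Steps F (.susp (envTh ((x, v.toResult) :: (f, .fix E f x e) :: E)) e) r.toTh := by
      intro hs
      obtain ⟨_, g, gx⟩ := hg hs
      cases gx with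
      | io gv gx =>
        have g' := g
        cases g with
        | fix gE ht hP =>
          cases ht with
          | fix ht =>
            have := S.liveEval_good hF hl (.cons (.cons gE g') gv) ht (S.sub .fix hP)
            exact ⟨_, _, g', gv, gx, this.1, this.2⟩
    obtain ⟨h, k⟩ := ih hF hK hW fun hs => by
      obtain ⟨_, _, _, _, gx, g, _⟩ := hg' hs
      exact ⟨_, g, gx⟩
    refine ⟨h, fun hs => ?_⟩
    obtain ⟨T₁, T₂, g, gv, gx, gr, st⟩ := hg' hs
    obtain ⟨s, hs, hx⟩ := k hs
    obtain ⟨s', hs'⟩ := S.exists_resume g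
    obtain ⟨g', st'⟩ := S.resume_self_good hs' g
    refine ⟨s', hs', .io (S.resume_of_conv (.app g' gv) gr ?_ hs) hx⟩
    exact (Conv.ofSteps (Steps.app st' .refl)).symm.trans (.ofSteps (.root .beta st))
  | hole =>
    intro hF hK hW hg
    rename_i F₀ E h ex
    have hm : (h, E, ex) ∈ A := by
      refine hA _ (hW (mem_worldsOf_singleton.2 ⟨rfl, by simp⟩)) fun hs => ?_
      obtain ⟨T, g, gx⟩ := hg hs
      cases g with | hole hΔ gE => exact ⟨_, _, hΔ, gE, gx⟩
    refine ⟨?_, fun hs => hs _ hm⟩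
    rintro ⟨n, w⟩ hw
    obtain ⟨rfl, hw'⟩ := mem_worldsOf_singleton.1 hw
    obtain rfl : w = (E, ex) := by simpa using hw'
    exact hm
  | app hd _ ih =>
    intro hF hK hW hg
    obtain rfl := hd.eq
    obtain ⟨h, k⟩ := ih hF hK hW fun hs => by
      obtain ⟨_, g, gx⟩ := hg hs
      cases g with | app g₁ g₂ => exact ⟨_, g₁, .io g₂ gx⟩
    refine ⟨h, fun hs => ?_⟩
    obtain ⟨s₁, hs₁, hx⟩ := k hs
    obtain ⟨_, g, gx⟩ := hg hs
    cases g with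
    | app g₁ g₂ =>
      obtain ⟨g₁', st⟩ := S.resume_self_good hs₁ g₁
      cases hx with
      | io hr hx =>
        exact ⟨_, S.resume_of_conv (.app g₁ g₂) (.app g₁' g₂) (.ofSteps (.app st .refl)) hr, hx⟩
  | prjFst _ ih =>
    intro hF hK hW hg
    obtain ⟨h, k⟩ := ih hF hK hW fun hs => by
      obtain ⟨_, g, gx⟩ := hg hs
      cases g with | prj g => exact ⟨_, g, .pair gx .top⟩
    refine ⟨h, fun hs => ?_⟩
    obtain ⟨s, hs, hx⟩ := k hs
    cases hx with | pair hx _ => exact ⟨_, .prj hs, hx⟩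
  | prjSnd _ ih =>
    intro hF hK hW hg
    obtain ⟨h, k⟩ := ih hF hK hW fun hs => by
      obtain ⟨_, g, gx⟩ := hg hs
      cases g with | prj g => exact ⟨_, g, .pair .top gx⟩
    refine ⟨h, fun hs => ?_⟩
    obtain ⟨s, hs, hx⟩ := k hs
    cases hx with | pair _ hx => exact ⟨_, .prj hs, hx⟩
  | @caseOf F₀ E r arms C x e r' ex K₁ K₂ K hm _ hl _ hM ih₁ ih₂ =>
    intro hF hK hW hg
    rw [hM.2.worldsOf_eq] at hW ⊢
    obtain ⟨h₁, k₁⟩ := ih₁ hF (hK.trans hM.1.extends_left) (fun _ h => hW (.inl h)) fun hs => by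
      obtain ⟨_, g, gx⟩ := hg hs
      cases g with
      | caseOf g hD _ ha _ _ =>
        obtain ⟨T', hC⟩ := exists_ctor_of_arm ha hm
        exact ⟨_, g, .ctor ⟨_, hD, hC⟩ .top⟩
    have hg' : AllSat F A → ∃ T, Good Sg Δ F P (.caseOf E r arms) T ∧ GoodEx Sg Δ F P ex T ∧
        Good Sg Δ F P r' T ∧ Conv F (Result.caseOf E r arms).toTh r'.toTh := by
      intro hs
      obtain ⟨s, hs₁, hx⟩ := k₁ hs
      cases hx
      rename_i s _
      obtain ⟨_, g', gx⟩ := hg hs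
      have g := g'
      cases g with
      | caseOf g hD gE ha hb hP =>
        have st := (S.resume_self_good hs₁ g).2
        obtain ⟨T', hC⟩ := exists_ctor_of_arm ha hm
        obtain ⟨gr, st'⟩ := S.liveEval_good hF hl
          (.cons gE (S.good_unwrap ⟨_, hD, hC⟩ g hs₁)) (hb _ _ _ _ hC hm) (S.sub (.arm hm) hP)
        refine ⟨_, g', gx, gr, ?_⟩
        have h₁ : Steps F (Result.caseOf E r arms).toTh
            (.susp (.cons x s.toTh (envTh E)) e) :=
          (Steps.caseOf .refl st).trans (Steps.root (.branch hm (S.wf.arm_unique hD ha hm)) .refl)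
        have h₂ : Steps F (.susp (envTh ((x, .unwrap C r) :: E)) e)
            (.susp (.cons x s.toTh (envTh E)) e) :=
          .susp (.cons ((Steps.unwrap st).trans (Steps.root .unwrap .refl)) .refl)
        exact ((Conv.ofSteps h₁).trans (Conv.ofSteps h₂).symm).trans (.ofSteps st')
    obtain ⟨h₂, k₂⟩ := ih₂ hF (hK.trans hM.1.extends_right) (fun _ h => hW (.inr h)) fun hs => by
      obtain ⟨_, _, gx, gr, _⟩ := hg' hs
      exact ⟨_, gr, gx⟩
    refine ⟨Set.union_subset h₁ h₂, fun hs => ?_⟩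
    obtain ⟨_, g, _, gr, hc⟩ := hg' hs
    obtain ⟨s, hs, hx⟩ := k₂ hs
    exact ⟨s, S.resume_of_conv g gr hc hs, hx⟩
  | unwrap _ ih =>
    intro hF hK hW hg
    obtain ⟨h, k⟩ := ih hF hK hW fun hs => by
      obtain ⟨_, g, gx⟩ := hg hs
      cases g with | unwrap hC g => exact ⟨_, g, .ctor hC gx⟩
    refine ⟨h, fun hs => ?_⟩
    obtain ⟨s, hs, hx⟩ := k hs
    cases hx with | ctor hx => exact ⟨_, .unwrap hs, hx⟩
  | @caseGuess F₀ Fg F₁ E r arms C x e r' r'' ex K K' hm _ hM hr hl _ hM' ih =>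
    intro hF hK hW hg
    rw [hM'.2.worldsOf_eq, worldsOf_empty, Set.empty_union] at hW ⊢
    have hF₁ : Extends F F₁ := hM.extends hF (hK.trans hM'.1.extends_left)
    have hg' : AllSat F A → ∃ T, Good Sg Δ F P (.caseOf E r arms) T ∧ GoodEx Sg Δ F P ex T ∧
        Good Sg Δ F P r'' T ∧ Steps F (Result.caseOf E r arms).toTh r''.toTh := by
      intro hs
      obtain ⟨_, g', gx⟩ := hg hs
      have g := g'
      cases g with
      | caseOf g hD gE ha hb hP =>
        obtain ⟨gr, st⟩ := S.resume_good hF₁ hr g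
        cases gr with
        | ctor hC gr =>
          obtain ⟨gr', st'⟩ := S.liveEval_good hF₁ hl (.cons gE gr)
            (hb _ _ _ _ (S.wf.mem_of_hasCtor hC hD) hm) (S.sub (.arm hm) hP)
          exact ⟨_, g', gx, gr', (Steps.caseOf .refl st).trans
            (Steps.root (.branch hm (S.wf.arm_unique hD ha hm)) st')⟩
    obtain ⟨h, k⟩ := ih hF₁ (hK.trans hM'.1.extends_right) hW fun hs => by
      obtain ⟨_, _, gx, gr, _⟩ := hg' hs
      exact ⟨_, gr, gx⟩
    refine ⟨h, fun hs => ?_⟩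
    obtain ⟨_, g, _, gr, st⟩ := hg' hs
    obtain ⟨s, hs, hx⟩ := k hs
    exact ⟨s, S.resume_of_conv g gr (.ofSteps st) hs, hx⟩

/-- Soundness of live bidirectional example checking. -/
theorem TotalOn.liveCheck_sound (S : TotalOn Sg Δ F P) {Gs : GuessFn} {Δ₀ F₀ e X K}
    (h : LiveCheck Gs Sg Δ₀ F₀ e X K) (hF : Extends F F₀) (hK : Extends F K.F) (hP : e ∈ P) :
    ∃ O : World → Set (Hole × World), (∀ o ∈ worldsOf K.U, ∃ w ∈ X, o ∈ O w) ∧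
      ∀ W A, worldsOf K.U ⊆ W → ClosedIn Sg Δ F P W A → ∀ w ∈ X,
        (AllSat F A → ∃ Γ T, GoodEnv Sg Δ F P w.1 Γ ∧ HasType Sg Δ Γ e T ∧ GoodEx Sg Δ F P w.2 T) →
        O w ⊆ A ∧ (AllSat F A → ∃ r s T, Good Sg Δ F P r T ∧
          Steps F (.susp (envTh w.1) e) r.toTh ∧ Resume F r s ∧ ExSat F s w.2) := by
  obtain ⟨ws, rfl, hws, hM⟩ := h
  have hU := hM.worldsOf_eq
  refine ⟨fun w => {o | ∃ p ∈ ws, p.1 = w ∧ o ∈ worldsOf p.2.U}, ?_, ?_⟩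
  · intro o ho
    rw [hU] at ho
    obtain ⟨K', hK', ho⟩ := ho
    obtain ⟨p, hp, rfl⟩ := List.mem_map.1 hK'
    exact ⟨p.1, by simpa using ⟨p.2, hp⟩, p, hp, rfl, ho⟩
  · intro W A hW hA w hw hg
    have key : ∀ p ∈ ws, p.1 = w → worldsOf p.2.U ⊆ A ∧ (AllSat F A → ∃ r s T,
        Good Sg Δ F P r T ∧ Steps F (.susp (envTh w.1) e) r.toTh ∧ Resume F r s ∧
          ExSat F s w.2) := by
      rintro p hp rfl
      obtain ⟨r, hl, hu⟩ := hws p hp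
      have hp' : p.2 ∈ ws.map Prod.snd := List.mem_map_of_mem hp
      have hg' : AllSat F A → ∃ T, Good Sg Δ F P r T ∧ GoodEx Sg Δ F P p.1.2 T ∧
          Steps F (.susp (envTh p.1.1) e) r.toTh := by
        intro hs
        obtain ⟨Γ, T, gE, ht, gx⟩ := hg hs
        obtain ⟨g, st⟩ := S.liveEval_good hF hl gE ht hP
        exact ⟨T, g, gx, st⟩
      obtain ⟨h₁, h₂⟩ := S.uneval_sound hA hu hF (hM.extends hK _ hp')
        (fun o ho => hW (by rw [hU]; exact ⟨_, hp', ho⟩)) fun hs => by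
          obtain ⟨T, g, gx, _⟩ := hg' hs
          exact ⟨T, g, gx⟩
      refine ⟨h₁, fun hs => ?_⟩
      obtain ⟨T, g, _, st⟩ := hg' hs
      obtain ⟨s, hs, hx⟩ := h₂ hs
      exact ⟨r, s, T, g, st, hs, hx⟩
    refine ⟨?_, ?_⟩
    · rintro o ⟨p, hp, rfl, ho⟩
      exact (key p hp rfl).1 ho
    · obtain ⟨p, hp, hpw⟩ : ∃ p ∈ ws, p.1 = w := by simpa using hw
      exact (key p hp hpw).2

/-- Checking the filling of a hole against its worlds. -/
theorem TotalOn.handles_of_liveCheck (S : TotalOn Sg Δ F P) {Gs : GuessFn} {Δ₀ F₀ h e X K}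
    (hc : LiveCheck Gs Sg Δ₀ F₀ e X K) (hF : Extends F F₀) (hK : Extends F K.F)
    (he : F.lookup h = some e) : Handles Sg Δ F P h X K.U := by
  obtain ⟨O, h₁, h₂⟩ := S.liveCheck_sound hc hF hK (S.code he)
  refine ⟨O, h₁, fun W A hW hA w hw hg => ?_⟩
  obtain ⟨h₃, h₄⟩ := h₂ W A hW hA w hw fun hs => (hg hs).type_of_lookup S he
  refine ⟨h₃, fun hs => ?_⟩
  obtain ⟨r, s, T, g, st, hr, hx⟩ := h₄ hs
  exact S.satWorld_of_conv (hg hs) he g (.ofSteps st) hr hx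

/-! ## Soundness of semantic merging -/

theorem TotalOn.step_sound (S : TotalOn Sg Δ F P) {Gs : GuessFn} {Δ₀ K K'}
    (h : Step Gs Sg Δ₀ K K') (hF : Extends F K'.F) (hK : Justified Sg Δ F P (worldsOf K.U)) :
    Justified Sg Δ F P (worldsOf K'.U) ∧
      (AllSat F (worldsOf K'.U) → AllSat F (worldsOf K.U)) := by
  obtain ⟨ks, K'', hn, hdom, hres, hL, hM⟩ := h
  have hFK : Extends F K.F := hF.trans hM.1.extends_left
  have hU : worldsOf K'.U = {w | ∃ K₁ ∈ ks.map Prod.snd, w ∈ worldsOf K₁.U} := by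
    rw [hM.2.worldsOf_eq, worldsOf_empty, Set.empty_union, hL.worldsOf_eq]
  have hex : ∀ h, ∃ K₁, h ∈ K.U → (h, K₁) ∈ ks := by
    intro h
    by_cases hU : h ∈ K.U
    · obtain ⟨⟨_, K₁⟩, hm, rfl⟩ := List.mem_map.1 ((hdom h).2 hU)
      exact ⟨K₁, fun _ => hm⟩
    · exact ⟨.empty, fun h => absurd h hU⟩
  choose V hV using hex
  refine hK.transfer (fun h => (V h).U) (fun h X hX => ?_) (fun o ho => ?_)
  · have hmem : (h, V h) ∈ ks := hV h (Finmap.mem_iff.2 ⟨X, hX⟩)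
    have hmem' : V h ∈ ks.map Prod.snd := List.mem_map_of_mem (f := Prod.snd) hmem
    refine ⟨?_, fun o ho => by rw [hU]; exact ⟨_, hmem', ho⟩⟩
    have hF₁ := hL.extends (hF.trans hM.1.extends_right) _ hmem'
    have hr := hres _ hmem X hX
    change Resolve Gs Sg Δ₀ K.F h X (V h) at hr
    revert hr hF₁
    generalize V h = K₁
    intro hF₁ hr
    cases hr with
    | filled he hc => exact S.handles_of_liveCheck hc hFK hF₁ (hFK _ _ he)
    | unfilled => exact handles_singleton
  · rw [hU] at ho
    obtain ⟨K₁, hK₁, ho⟩ := ho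
    obtain ⟨⟨h, K₁⟩, hp, rfl⟩ := List.mem_map.1 hK₁
    have hU := (hdom h).1 (List.mem_map_of_mem (f := Prod.fst) hp)
    obtain ⟨X, hX⟩ := Finmap.mem_iff.1 hU
    refine ⟨h, X, hX, ?_⟩
    have := List.inj_on_of_nodup_map hn hp (hV h hU) rfl
    simp only [Prod.mk.injEq, true_and] at this
    rwa [← this]

theorem Step.extends {Gs : GuessFn} {Δ₀ K K'} (h : Step Gs Sg Δ₀ K K') : Extends K'.F K.F := by
  obtain ⟨ks, K'', -, -, -, -, hM⟩ := h
  exact hM.1.extends_left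

theorem SemMerge.extends {Gs : GuessFn} {Δ₀ K K'} (h : SemMerge Gs Sg Δ₀ K K') :
    Extends K'.F K.F := by
  induction h with
  | next h _ _ ih => exact ih.trans h.extends
  | stop_here h _ => exact h.extends

theorem TotalOn.semMerge_sound (S : TotalOn Sg Δ F P) {Gs : GuessFn} {Δ₀ K K'}
    (h : SemMerge Gs Sg Δ₀ K K') (hF : Extends F K'.F) (hK : Justified Sg Δ F P (worldsOf K.U)) :
    Justified Sg Δ F P (worldsOf K'.U) ∧
      (AllSat F (worldsOf K'.U) → AllSat F (worldsOf K.U)) := by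
  induction h with
  | next h _ hm ih =>
    obtain ⟨h₁, h₂⟩ := S.step_sound h (hF.trans hm.extends) hK
    obtain ⟨h₃, h₄⟩ := ih hF h₁
    exact ⟨h₃, fun h => h₂ (h₄ h)⟩
  | stop_here h _ => exact S.step_sound h hF hK

end

/-! ## Weakening of hole contexts -/

/-- A hole context that extends `Δ₀`. -/
def ExtendsCtx (Δ Δ₀ : HoleCtx) : Prop := ∀ h c, Δ₀.lookup h = some c → Δ.lookup h = some c

theorem ExtendsCtx.trans {Δ₁ Δ₂ Δ₃ : HoleCtx} (h₁ : ExtendsCtx Δ₁ Δ₂) (h₂ : ExtendsCtx Δ₂ Δ₃) :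
    ExtendsCtx Δ₁ Δ₃ := fun n c h => h₁ n c (h₂ n c h)

theorem extendsCtx_union (Δ Δ' : HoleCtx) : ExtendsCtx (Δ ∪ Δ') Δ :=
  fun _ _ h => Finmap.mem_lookup_union.2 (.inl h)

theorem HasType.weaken {Sg Δ Δ₀ Γ e T} (h : HasType Sg Δ₀ Γ e T) (hΔ : ExtendsCtx Δ Δ₀) :
    HasType Sg Δ Γ e T := by
  induction h with
  | fix _ ih => exact .fix ih
  | var h => exact .var h
  | hole h => exact .hole (hΔ _ _ h)
  | unit => exact .unit
  | pair _ _ ih₁ ih₂ => exact .pair ih₁ ih₂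
  | ctor hC _ ih => exact .ctor hC ih
  | app _ _ ih₁ ih₂ => exact .app ih₁ ih₂
  | prj _ ih => exact .prj ih
  | caseOf _ hD ha _ ih₁ ih₂ => exact .caseOf ih₁ hD ha ih₂

theorem FillingTyped.weaken {Sg Δ Δ₀ F} (h : FillingTyped Sg Δ₀ F) (hΔ : ExtendsCtx Δ Δ₀) :
    FillingTyped Sg Δ F := fun n e he =>
  let ⟨Γ, T, h₁, h₂⟩ := h n e he
  ⟨Γ, T, hΔ _ _ h₁, h₂.weaken hΔ⟩

section

variable {Sg : DataCtx} {Δ Δ₀ : HoleCtx} {F : Filling} {P : Set Exp}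

theorem ResultTyped.good {r T} (h : ResultTyped Sg Δ₀ r T) (hΔ : ExtendsCtx Δ Δ₀) :
    CodeIn P r → Good Sg Δ F P r T := by
  induction h using ResultTyped.rec (motive_2 := fun E Γ _ => EnvCodeIn P E →
    GoodEnv Sg Δ F P E Γ) with
  | fix _ ht ih => intro c; cases c with | fix c hP => exact .fix (ih c) (ht.weaken hΔ) hP
  | hole h _ ih => intro c; cases c with | hole c => exact .hole (hΔ _ _ h) (ih c)
  | unit => intro _; exact .unit
  | pair _ _ ih₁ ih₂ => intro c; cases c with | pair c₁ c₂ => exact .pair (ih₁ c₁) (ih₂ c₂)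
  | ctor hC _ ih => intro c; cases c with | ctor c => exact .ctor hC (ih c)
  | app _ _ ih₁ ih₂ => intro c; cases c with | app c₁ c₂ => exact .app (ih₁ c₁) (ih₂ c₂)
  | prj _ ih => intro c; cases c with | prj c => exact .prj (ih c)
  | caseOf _ hD _ ha hb ih₁ ih₂ =>
    intro c
    cases c with
    | caseOf cE c hP =>
      exact .caseOf (ih₁ c) hD (ih₂ cE) ha
        (fun C T' x e' h h' => (hb C T' x e' h h').weaken hΔ) hP
  | nil => rename_i c; exact .nil
  | cons _ _ ih₁ ih₂ => rename_i c; cases c with | cons cE c => exact .cons (ih₁ cE) (ih₂ c)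

theorem EnvTyped.good {E Γ} (h : EnvTyped Sg Δ₀ E Γ) (hΔ : ExtendsCtx Δ Δ₀) (c : EnvCodeIn P E) :
    GoodEnv Sg Δ F P E Γ := by
  induction E generalizing Γ with
  | nil => cases h; exact .nil
  | cons p E ih =>
    cases h with
    | cons hE hr => cases c with | cons cE c => exact .cons (ih hE cE) (hr.good hΔ c)

theorem Val.codeIn : ∀ v : Val, CodeIn P v.toResult
  | .unit => .unit
  | .pair v₁ v₂ => .pair v₁.codeIn v₂.codeIn
  | .ctor _ v => .ctor v.codeIn

theorem ExTyped.good {ex T} (h : ExTyped Sg Δ₀ ex T) (hΔ : ExtendsCtx Δ Δ₀) :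
    GoodEx Sg Δ F P ex T := by
  induction h with
  | unit => exact .unit
  | pair _ _ ih₁ ih₂ => exact .pair ih₁ ih₂
  | ctor hC _ ih => exact .ctor hC ih
  | io hv _ ih => exact .io (hv.good hΔ (Val.codeIn _)) ih
  | top => exact .top

theorem Guess.hasType {Γ T e} (h : Guess Sg Γ T e) : HasType Sg Δ Γ e T := by
  induction h with
  | unit => exact .unit
  | pair _ _ ih₁ ih₂ => exact .pair ih₁ ih₂
  | ctor hC _ ih => exact .ctor hC ih
  | fix _ ih => exact .fix ih
  | caseOf hD _ ha _ ih₁ ih₂ => exact .caseOf ih₁ hD ha ih₂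
  | var h => exact .var h
  | app _ _ ih₁ ih₂ => exact .app ih₁ ih₂
  | prj _ ih => exact .prj ih

end

/-! ## Goals -/

theorem mem_worldsOf_goals {G : List Goal} {w} (h : w ∈ worldsOf (goalsUnfilled G)) :
    ∃ g ∈ G, g.h = w.1 ∧ w.2 ∈ g.X := by
  obtain ⟨X, hX, hw⟩ := h
  rw [goalsUnfilled, Finmap.dlookup_list_toFinmap] at hX
  obtain ⟨g, hg, he⟩ := List.mem_map.1 (List.of_mem_dlookup hX)
  obtain ⟨n, w⟩ := w
  cases he
  exact ⟨g, hg, rfl, hw⟩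

theorem worldsOf_goals {G : List Goal} (hn : (G.map Goal.h).Nodup) {g : Goal} (hg : g ∈ G) {w}
    (hw : w ∈ g.X) : (g.h, w) ∈ worldsOf (goalsUnfilled G) := by
  refine ⟨g.X, ?_, hw⟩
  rw [goalsUnfilled, Finmap.dlookup_list_toFinmap]
  refine (List.mem_dlookup_iff ?_).2 (List.mem_map.2 ⟨g, hg, rfl⟩)
  simpa [List.NodupKeys, List.keys, Function.comp_def] using hn

theorem goalsCtx_lookup {G : List Goal} (hn : (G.map Goal.h).Nodup) {g : Goal} (hg : g ∈ G) :
    (goalsCtx G).lookup g.h = some (g.Γ, g.T) := by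
  rw [goalsCtx, Finmap.dlookup_list_toFinmap]
  refine (List.mem_dlookup_iff ?_).2 (List.mem_map.2 ⟨g, hg, rfl⟩)
  simpa [List.NodupKeys, List.keys, Function.comp_def] using hn

theorem goalsCtx_lookup_union {Δ : HoleCtx} {G : List Goal} (hn : (G.map Goal.h).Nodup)
    (hf : ∀ g ∈ G, g.h ∉ Δ) {g : Goal} (hg : g ∈ G) :
    (Δ ∪ goalsCtx G).lookup g.h = some (g.Γ, g.T) := by
  rw [Finmap.lookup_union_right (hf g hg), goalsCtx_lookup hn hg]

section

variable {Sg : DataCtx} {Δ Δ₀ : HoleCtx} {F : Filling} {P : Set Exp} {Γ : Ctx} {X : Worlds} {T : Ty}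

theorem Refine.fresh {e G} (h : Refine Sg Δ₀ Γ X T e G) :
    (G.map Goal.h).Nodup ∧ ∀ g ∈ G, g.h ∉ Δ₀ := by
  cases h <;> simp_all

theorem Branch.fresh {Gs : GuessFn} {e G K} (h : Branch Gs Sg Δ₀ F Γ X T e G K) :
    (G.map Goal.h).Nodup ∧ ∀ g ∈ G, g.h ∉ Δ₀ := by
  cases h with
  | mk J as _ _ _ _ _ hf hn _ =>
    refine ⟨by simpa [Function.comp_def] using hn, fun g hg => ?_⟩
    obtain ⟨a, ha, rfl⟩ := List.mem_map.1 hg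
    exact hf a ha

theorem mem_filterTop {w : World} (hw : w ∈ X) (h : w.2 ≠ .top) : w ∈ filterTop X := by
  simp [filterTop, hw, h]

theorem mem_of_mem_filterTop {w : World} (hw : w ∈ filterTop X) : w ∈ X := by
  simp only [filterTop, Finset.mem_filter] at hw
  exact hw.1

/-- The goals of a refinement handle the refined worlds. -/
theorem TotalOn.refine_handles (S : TotalOn Sg Δ F P) {h e G} (hr : Refine Sg Δ₀ Γ X T e G)
    (hΔ : Δ.lookup h = some (Γ, T)) (hG : ∀ g ∈ G, Δ.lookup g.h = some (g.Γ, g.T))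
    (he : F.lookup h = some e) : Handles Sg Δ F P h X (goalsUnfilled G) := by
  have hn := hr.fresh.1
  have htype : ∀ {w}, GoodWorld Sg Δ F P (h, w) →
      GoodEnv Sg Δ F P w.1 Γ ∧ GoodEx Sg Δ F P w.2 T := by
    rintro w ⟨Γ', T', h', gE, gx⟩
    cases hΔ.symm.trans h'
    exact ⟨gE, gx⟩
  cases hr with
  | unit hX =>
    refine ⟨fun _ => ∅, fun o ho => ?_, fun W A hW hA w hw hg => ⟨by simp, fun hs => ?_⟩⟩
    · obtain ⟨g, hg, -⟩ := mem_worldsOf_goals ho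
      simp at hg
    · obtain ⟨E, ex⟩ := w
      by_cases hx : ex = .top
      · subst hx; exact S.satWorld_top (hg hs)
      · obtain rfl : ex = .unit := hX _ (mem_filterTop hw hx)
        exact S.satWorld_of_conv (hg hs) he .unit (.ofSteps (.root .unit .refl)) .unit .unit
  | @pair T₁ T₂ h₁ h₂ L hL _ _ _ =>
    refine ⟨fun w => {o | ∃ ex₁ ex₂, w.2 = .pair ex₁ ex₂ ∧
      (o = (h₁, w.1, ex₁) ∨ o = (h₂, w.1, ex₂))},
      fun o ho => ?_, fun W A hW hA w hw hg => ?_⟩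
    · obtain ⟨g, hg, hgo, ho⟩ := mem_worldsOf_goals ho
      obtain ⟨n, w⟩ := o
      simp only [List.mem_cons, List.not_mem_nil, or_false] at hg
      rcases hg with rfl | rfl
      all_goals
        obtain rfl : _ = n := hgo
        obtain ⟨⟨E, ex₁, ex₂⟩, hl, rfl⟩ := List.mem_map.1 (List.mem_toFinset.1 ho)
        refine ⟨(E, .pair ex₁ ex₂), mem_of_mem_filterTop ?_, ex₁, ex₂, rfl, by simp⟩
        rw [hL]
        simp only [List.mem_toFinset, List.mem_map]
        exact ⟨_, hl, rfl⟩
    · have hO : ∀ {E ex₁ ex₂}, w = (E, .pair ex₁ ex₂) → (h₁, E, ex₁) ∈ A ∧ (h₂, E, ex₂) ∈ A := by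
        rintro E ex₁ ex₂ rfl
        have hl := mem_filterTop hw (by simp)
        rw [hL] at hl
        simp only [List.mem_toFinset, List.mem_map] at hl
        obtain ⟨l, hl, hll⟩ := hl
        obtain ⟨E', ex₁', ex₂'⟩ := l
        cases hll
        refine ⟨hA _ (hW (worldsOf_goals hn (.head _) ?_)) fun hs => ?_,
          hA _ (hW (worldsOf_goals hn (.tail _ (.head _)) ?_)) fun hs => ?_⟩
        · simp only [List.mem_toFinset, List.mem_map]
          exact ⟨_, hl, rfl⟩
        · obtain ⟨gE, gx⟩ := htype (hg hs)
          cases gx with | pair gx _ => exact ⟨_, _, hG _ (.head _), gE, gx⟩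
        · simp only [List.mem_toFinset, List.mem_map]
          exact ⟨_, hl, rfl⟩
        · obtain ⟨gE, gx⟩ := htype (hg hs)
          cases gx with | pair _ gx => exact ⟨_, _, hG _ (.tail _ (.head _)), gE, gx⟩
      obtain ⟨E, ex⟩ := w
      refine ⟨?_, fun hs => ?_⟩
      · rintro o ⟨ex₁, ex₂, rfl, rfl | rfl⟩
        · exact (hO rfl).1
        · exact (hO rfl).2
      · by_cases hx : ex = .top
        · subst hx; exact S.satWorld_top (hg hs)
        · have hl := mem_filterTop hw hx
          rw [hL] at hl
          simp only [List.mem_toFinset, List.mem_map] at hl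
          obtain ⟨l, hl, hll⟩ := hl
          cases hll
          obtain ⟨gE, -⟩ := htype (hg hs)
          obtain ⟨s₁, hs₁, hx₁⟩ := hs _ (hO rfl).1
          obtain ⟨s₂, hs₂, hx₂⟩ := hs _ (hO rfl).2
          exact S.satWorld_of_conv (hg hs) he
            (.pair (.hole (hG _ (.head _)) gE) (.hole (hG _ (.tail _ (.head _))) gE))
            (.ofSteps (.root .pair .refl)) (.pair hs₁ hs₂) (.pair hx₁ hx₂)
  | @ctor C T₁ D h₁ L hL hC _ =>
    refine ⟨fun w => {o | ∃ ex, w.2 = .ctor C ex ∧ o = (h₁, w.1, ex)},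
      fun o ho => ?_, fun W A hW hA w hw hg => ?_⟩
    · obtain ⟨g, hg, hgo, ho⟩ := mem_worldsOf_goals ho
      obtain ⟨n, E, ex⟩ := o
      simp only [List.mem_cons, List.not_mem_nil, or_false] at hg
      subst hg
      obtain rfl : _ = n := hgo
      refine ⟨(E, .ctor C ex), mem_of_mem_filterTop ?_, ex, rfl, rfl⟩
      rw [hL]
      simp only [List.mem_toFinset, List.mem_map]
      exact ⟨(E, ex), List.mem_toFinset.1 ho, rfl⟩
    · have hO : ∀ {E ex}, w = (E, .ctor C ex) → (h₁, E, ex) ∈ A := by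
        rintro E ex rfl
        have hl := mem_filterTop hw (by simp)
        rw [hL] at hl
        simp only [List.mem_toFinset, List.mem_map] at hl
        obtain ⟨l, hl, hll⟩ := hl
        obtain ⟨E', ex'⟩ := l
        cases hll
        refine hA _ (hW (worldsOf_goals hn (.head _) ?_)) fun hs => ?_
        · simpa using hl
        · obtain ⟨gE, gx⟩ := htype (hg hs)
          cases gx with
          | ctor hC' gx =>
            obtain rfl := S.wf.ctor_unique hC hC'
            exact ⟨_, _, hG _ (.head _), gE, gx⟩
      obtain ⟨E, ex⟩ := w
      refine ⟨?_, fun hs => ?_⟩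
      · rintro o ⟨ex, rfl, rfl⟩
        exact hO rfl
      · by_cases hx : ex = .top
        · subst hx; exact S.satWorld_top (hg hs)
        · have hl := mem_filterTop hw hx
          rw [hL] at hl
          simp only [List.mem_toFinset, List.mem_map] at hl
          obtain ⟨l, hl, hll⟩ := hl
          cases hll
          obtain ⟨gE, -⟩ := htype (hg hs)
          obtain ⟨s₁, hs₁, hx₁⟩ := hs _ (hO rfl)
          exact S.satWorld_of_conv (hg hs) he (.ctor hC (.hole (hG _ (.head _)) gE))
            (.ofSteps (.root .ctor .refl)) (.ctor hs₁) (.ctor hx₁)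
  | @fix T₁ T₂ f x h₁ L hL _ =>
    have ht : HasType Sg Δ Γ (.fix f x (.hole h₁)) (.arrow T₁ T₂) := .fix (.hole (hG _ (.head _)))
    refine ⟨fun w => {o | ∃ v ex, w.2 = .io v ex ∧
      o = (h₁, (x, v.toResult) :: (f, .fix w.1 f x (.hole h₁)) :: w.1, ex)},
      fun o ho => ?_, fun W A hW hA w hw hg => ?_⟩
    · obtain ⟨g, hg, hgo, ho⟩ := mem_worldsOf_goals ho
      obtain ⟨n, w⟩ := o
      simp only [List.mem_cons, List.not_mem_nil, or_false] at hg
      subst hg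
      obtain rfl : _ = n := hgo
      obtain ⟨⟨E, v, ex⟩, hl, rfl⟩ := List.mem_map.1 (List.mem_toFinset.1 ho)
      refine ⟨(E, .io v ex), mem_of_mem_filterTop ?_, v, ex, rfl, rfl⟩
      rw [hL]
      simp only [List.mem_toFinset, List.mem_map]
      exact ⟨_, hl, rfl⟩
    · have hE : ∀ {E v ex}, GoodWorld Sg Δ F P (h, E, .io v ex) →
          GoodEnv Sg Δ F P ((x, v.toResult) :: (f, .fix E f x (.hole h₁)) :: E)
            ((x, T₁) :: (f, .arrow T₁ T₂) :: Γ) ∧ GoodEx Sg Δ F P ex T₂ := by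
        intro E v ex hg
        obtain ⟨gE, gx⟩ := htype hg
        cases gx with
        | io gv gx => exact ⟨.cons (.cons gE (.fix gE ht (S.code he))) gv, gx⟩
      have hO : ∀ {E v ex}, w = (E, .io v ex) →
          (h₁, (x, v.toResult) :: (f, .fix E f x (.hole h₁)) :: E, ex) ∈ A := by
        rintro E v ex rfl
        have hl := mem_filterTop hw (by simp)
        rw [hL] at hl
        simp only [List.mem_toFinset, List.mem_map] at hl
        obtain ⟨l, hl, hll⟩ := hl
        obtain ⟨E', v', ex'⟩ := l
        cases hll
        refine hA _ (hW (worldsOf_goals hn (.head _) ?_)) fun hs => ?_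
        · simp only [List.mem_toFinset, List.mem_map]
          exact ⟨_, hl, rfl⟩
        · obtain ⟨gE, gx⟩ := hE (hg hs)
          exact ⟨_, _, hG _ (.head _), gE, gx⟩
      obtain ⟨E, ex⟩ := w
      refine ⟨?_, fun hs => ?_⟩
      · rintro o ⟨v, ex, rfl, rfl⟩
        exact hO rfl
      · by_cases hx : ex = .top
        · subst hx; exact S.satWorld_top (hg hs)
        · have hl := mem_filterTop hw hx
          rw [hL] at hl
          simp only [List.mem_toFinset, List.mem_map] at hl
          obtain ⟨⟨E', v, ex'⟩, hl, hll⟩ := hl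
          cases hll
          obtain ⟨gE, gx⟩ := htype (hg hs)
          obtain ⟨gE', -⟩ := hE (hg hs)
          obtain ⟨s₁, hs₁, hx₁⟩ := hs _ (hO rfl)
          have g : Good Sg Δ F P (.fix _ f x (.hole h₁)) (.arrow T₁ T₂) := .fix gE ht (S.code he)
          obtain ⟨s, hs'⟩ := S.exists_resume g
          obtain ⟨g', st⟩ := S.resume_self_good hs' g
          cases gx with
          | io gv gx =>
            refine S.satWorld_of_conv (hg hs) he g (.ofSteps .refl) hs' (.io
              (S.resume_of_conv (.app g' gv) (.hole (hG _ (.head _)) gE') ?_ hs₁) hx₁)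
            exact (Conv.ofSteps (Steps.app st .refl)).symm.trans
              (.ofSteps (.root .beta .refl))

theorem TotalOn.collapse_good (S : TotalOn Sg Δ F P) {C r s D T₁} (hC : Sg.HasCtor C T₁ D)
    (g : Good Sg Δ F P r (.data D)) (hr : Resume F r (.ctor C s)) :
    Good Sg Δ F P (collapse C r) T₁ ∧
      ∃ t, Steps F r.toTh (.ctor C t) ∧ Steps F (collapse C r).toTh t := by
  have hu := S.good_unwrap hC g hr
  have hu' : ∃ t, Steps F r.toTh (.ctor C t) ∧ Steps F (Result.unwrap C r).toTh t :=
    ⟨s.toTh, (S.resume_self_good hr g).2,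
      (Steps.unwrap (S.resume_self_good hr g).2).trans (Steps.root .unwrap .refl)⟩
  unfold collapse
  split
  · split
    · rename_i hCC
      subst hCC
      cases g with
      | ctor hC' g =>
        obtain rfl := S.wf.ctor_unique hC hC'
        exact ⟨g, _, .refl, .refl⟩
    · exact ⟨hu, hu'⟩
  · exact ⟨hu, hu'⟩

/-- The goals of a branching, and the constraints on its scrutinee, handle the branched worlds. -/
theorem TotalOn.branch_handles (S : TotalOn Sg Δ F P) {Gs : GuessFn} {F₀ h e G K U}
    (hb : Branch Gs Sg Δ₀ F₀ Γ X T e G K) (hU : MergeU (goalsUnfilled G) K.U U)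
    (hF : Extends F F₀) (hK : Extends F K.F)
    (hΔ : Δ.lookup h = some (Γ, T)) (hG : ∀ g ∈ G, Δ.lookup g.h = some (g.Γ, g.T))
    (he : F.lookup h = some e) : Handles Sg Δ F P h X U := by
  have hn := hb.fresh.1
  have htype : ∀ {w}, GoodWorld Sg Δ F P (h, w) →
      GoodEnv Sg Δ F P w.1 Γ ∧ GoodEx Sg Δ F P w.2 T := by
    rintro w ⟨Γ', T', h', gE, gx⟩
    cases hΔ.symm.trans h'
    exact ⟨gE, gx⟩
  cases hb with
  | @mk D cs e K J as hD hguess hX hJ has hf hnd hM =>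
    have hP := S.code he
    have hPe : e ∈ P := S.sub .scrut hP
    have hte : HasType Sg Δ Γ e (.data D) := hguess.hasType
    have hUw := hU.worldsOf_eq
    rw [hM.worldsOf_eq] at hUw
    have harms : (as.map fun a => (a.C, a.x, Exp.hole a.h)).map Prod.fst = cs.map Prod.fst := by
      rw [← has]
      simp
    refine ⟨fun w => {o | ∃ j ∈ J, (j.E, j.ex) = w ∧ (o ∈ worldsOf j.K.U ∨ ∃ a ∈ as, j.C = a.C ∧
      o = (a.h, (a.x, collapse a.C j.r) :: j.E, j.ex))},
      fun o ho => ?_, fun W A hW hA w hw hg => ?_⟩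
    · have hmem : ∀ j ∈ J, (j.E, j.ex) ∈ X := by
        intro j hj
        refine mem_of_mem_filterTop ?_
        rw [hX]
        simp only [List.mem_toFinset, List.mem_map]
        exact ⟨j, hj, rfl⟩
      rw [hUw] at ho
      rcases ho with ho | ⟨K', hK', ho⟩
      · obtain ⟨g, hg, hgo, ho⟩ := mem_worldsOf_goals ho
        obtain ⟨n, w⟩ := o
        obtain ⟨a, ha, rfl⟩ := List.mem_map.1 hg
        obtain rfl : _ = n := hgo
        obtain ⟨j, hj, rfl⟩ := List.mem_map.1 (List.mem_toFinset.1 ho)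
        obtain ⟨hj, hjC⟩ := List.mem_filter.1 hj
        exact ⟨_, hmem j hj, j, hj, rfl, .inr ⟨a, ha, of_decide_eq_true hjC, rfl⟩⟩
      · obtain ⟨j, hj, rfl⟩ := List.mem_map.1 hK'
        exact ⟨_, hmem j hj, j, hj, rfl, .inl ho⟩
    · have key : ∀ j ∈ J, (j.E, j.ex) = w → worldsOf j.K.U ⊆ A ∧ ∀ a ∈ as, j.C = a.C →
          (AllSat F A → GoodEnv Sg Δ F P ((a.x, collapse a.C j.r) :: j.E) ((a.x, a.T) :: Γ) ∧
            Conv F (.susp (envTh j.E) (.caseOf e (as.map fun a => (a.C, a.x, Exp.hole a.h))))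
              (.susp (envTh ((a.x, collapse a.C j.r) :: j.E)) (.hole a.h))) ∧
          (a.h, (a.x, collapse a.C j.r) :: j.E, j.ex) ∈ A := by
        rintro j hj rfl
        obtain ⟨hev, hCcs, hlc⟩ := hJ j hj
        obtain ⟨⟨_, T₁⟩, hCT, hCj⟩ := List.mem_map.1 hCcs
        simp only at hCj
        subst hCj
        have hjK : j.K ∈ J.map Choice.K := List.mem_map_of_mem hj
        obtain ⟨O, hO, hO'⟩ := S.liveCheck_sound hlc hF (hM.extends hK _ hjK) hPe
        obtain ⟨hOA, hsat⟩ := hO' W A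
          (fun o ho => hW (by rw [hUw]; exact .inr ⟨_, hjK, ho⟩)) hA (j.E, .ctor j.C .top)
          (by simp) fun hs => ⟨_, _, (htype (hg hs)).1, hte, .ctor ⟨cs, hD, hCT⟩ .top⟩
        have hKA : worldsOf j.K.U ⊆ A := by
          intro o ho
          obtain ⟨w, hw, ho⟩ := hO o ho
          obtain rfl := Finset.mem_singleton.1 hw
          exact hOA ho
        refine ⟨hKA, fun a ha hCa => ?_⟩
        have haT : (a.C, a.T) ∈ cs := by
          rw [← has]
          exact List.mem_map_of_mem (f := fun a : Arm => (a.C, a.T)) ha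
        have ham : (a.C, a.x, Exp.hole a.h) ∈ as.map fun a => (a.C, a.x, Exp.hole a.h) :=
          List.mem_map_of_mem (f := fun a : Arm => (a.C, a.x, Exp.hole a.h)) ha
        have hgood : AllSat F A → GoodEnv Sg Δ F P ((a.x, collapse a.C j.r) :: j.E)
            ((a.x, a.T) :: Γ) ∧
            Conv F (.susp (envTh j.E) (.caseOf e (as.map fun a => (a.C, a.x, Exp.hole a.h))))
              (.susp (envTh ((a.x, collapse a.C j.r) :: j.E)) (.hole a.h)) := by
          intro hs
          have gE := (htype (hg hs)).1
          obtain ⟨r, s, T', g, st, hr, hx⟩ := hsat hs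
          cases hx
          rename_i s _
          obtain ⟨gj, stj⟩ := S.eval_good hev gE hte hPe
          have hrj := S.resume_of_conv gj g
            ((Conv.ofSteps stj).symm.trans (.ofSteps st)) hr
          rw [hCa] at hrj
          obtain ⟨gc, t, st₁, st₂⟩ := S.collapse_good ⟨cs, hD, haT⟩ gj hrj
          refine ⟨.cons gE gc, .trans (.ofSteps ?_)
            (Conv.ofSteps (Steps.susp (Steps.cons st₂ .refl))).symm⟩
          exact .root .caseOf ((Steps.caseOf .refl (stj.trans st₁)).trans
            (Steps.root (.branch ham (S.wf.arm_unique hD harms ham)) .refl))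
        have hag := List.mem_map_of_mem
          (f := fun a : Arm => (⟨a.h, (a.x, a.T) :: Γ, T, a.worlds J⟩ : Goal)) ha
        refine ⟨hgood, hA _ (hW ?_) fun hs => ⟨_, _, hG _ hag, (hgood hs).1, (htype (hg hs)).2⟩⟩
        rw [hUw]
        refine .inl (worldsOf_goals hn hag ?_)
        simp only [Arm.worlds, List.mem_toFinset, List.mem_map, List.mem_filter,
          decide_eq_true_eq]
        exact ⟨j, ⟨hj, hCa⟩, rfl⟩
      refine ⟨?_, fun hs => ?_⟩
      · rintro o ⟨j, hj, hjw, ho | ⟨a, ha, hCa, rfl⟩⟩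
        · exact (key j hj hjw).1 ho
        · exact ((key j hj hjw).2 a ha hCa).2
      · obtain ⟨E, ex⟩ := w
        by_cases hx : ex = .top
        · subst hx; exact S.satWorld_top (hg hs)
        · have hl := mem_filterTop hw hx
          rw [hX] at hl
          simp only [List.mem_toFinset, List.mem_map] at hl
          obtain ⟨j, hj, hjw⟩ := hl
          obtain ⟨a, ha, haC⟩ : ∃ a ∈ as, a.C = j.C := by
            have := (hJ j hj).2.1
            rw [← has] at this
            simpa using this
          obtain ⟨h₁, h₂⟩ := (key j hj hjw).2 a ha haC.symm
          obtain ⟨gE, hc⟩ := h₁ hs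
          obtain ⟨s, hs', hx'⟩ := hs _ h₂
          cases hjw
          have hag := List.mem_map_of_mem
            (f := fun a : Arm => (⟨a.h, (a.x, a.T) :: Γ, T, a.worlds J⟩ : Goal)) ha
          exact S.satWorld_of_conv (hg hs) he (.hole (hG _ hag) gE) hc hs' hx'

/-- Hole synthesis handles the worlds of the hole. -/
theorem TotalOn.fill_handles (S : TotalOn Sg Δ F P) {Gs : GuessFn} {F₀ h K Δ₁}
    (hf : Fill Gs Sg Δ₀ h F₀ Γ X T K Δ₁) (hF : Extends F F₀) (hK : Extends F K.F)
    (hΔ : ExtendsCtx Δ (Δ₀ ∪ Δ₁)) (hh : Δ₀.lookup h = some (Γ, T)) :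
    Handles Sg Δ F P h X K.U := by
  have hh' := hΔ _ _ (extendsCtx_union _ _ _ _ hh)
  have hsing : ∀ {e : Exp}, (Finmap.singleton (β := fun _ : Hole => Exp) h e).lookup h = some e :=
    Finmap.lookup_singleton_eq
  cases hf with
  | guessAndCheck hguess hc hM =>
    have he := hK _ _ (hM.1.extends_left _ _ hsing)
    obtain ⟨O, h₁, h₂⟩ := S.handles_of_liveCheck (F₀ := F₀.insert h _) hc (fun n e' hn => by
      by_cases hnh : n = h
      · subst hnh
        rw [Finmap.lookup_insert] at hn
        cases hn
        exact he
      · rw [Finmap.lookup_insert_of_ne _ hnh] at hn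
        exact hF _ _ hn) (hK.trans hM.1.extends_right) he
    have := hM.2.worldsOf_eq
    rw [worldsOf_empty, Set.empty_union] at this
    exact ⟨O, by rwa [this], by rwa [this]⟩
  | defer hne htop =>
    refine ⟨fun _ => ∅, by simp [worldsOf_empty], fun W A hW hA w hw hg => ⟨by simp, fun hs => ?_⟩⟩
    obtain ⟨E, ex⟩ := w
    obtain rfl : ex = .top := htop _ hw
    exact S.satWorld_top (hg hs)
  | refine hr =>
    obtain ⟨h₁, h₂⟩ := hr.fresh
    exact S.refine_handles hr hh' (fun g hg => hΔ _ _ (goalsCtx_lookup_union h₁ h₂ hg))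
      (hK _ _ hsing)
  | branch hb hM =>
    obtain ⟨h₁, h₂⟩ := hb.fresh
    exact S.branch_handles hb hM.2 hF (hK.trans hM.1.extends_right) hh'
      (fun g hg => hΔ _ _ (goalsCtx_lookup_union h₁ h₂ hg))
      (hK _ _ (hM.1.extends_left _ _ hsing))

end

/-! ## Solving -/

section

variable {Sg : DataCtx} {Gs : GuessFn}

theorem Solve.extends {Δ K F Δ'} (h : Solve Gs Sg Δ K F Δ') :
    Extends F K.F ∧ ExtendsCtx Δ' Δ := by
  induction h with
  | done => exact ⟨fun _ _ h => h, fun _ _ h => h⟩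
  | one _ _ _ hM hS _ ih =>
    exact ⟨ih.1.trans (hS.extends.trans hM.1.extends_left), ih.2.trans (extendsCtx_union _ _)⟩

theorem TotalOn.solve_sound {Δ K F Δ' P} (h : Solve Gs Sg Δ K F Δ') (S : TotalOn Sg Δ' F P)
    (hK : Justified Sg Δ' F P (worldsOf K.U)) : AllSat F (worldsOf K.U) := by
  induction h with
  | done => simp [AllSat, worldsOf_empty]
  | @one Δ Δ₁ Δ'' h F₀ F U X Γ T K K₁ K' hX hΔ hf hM hS hs ih =>
    have hF₁ : Extends F K₁.F := hs.extends.1.trans hS.extends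
    have hH := S.fill_handles hf (hF₁.trans hM.1.extends_left) (hF₁.trans hM.1.extends_right)
      hs.extends.2 hΔ
    have hU := hM.2.worldsOf_eq
    obtain ⟨h₁, h₂⟩ := hK.transfer (U' := K₁.U)
      (fun h' => if h' = h then K.U else
        ((U.lookup h').map fun X => Finmap.singleton h' X).getD ∅) (fun h' X' hX' => by
        by_cases hh : h' = h
        · subst hh
          cases hX.symm.trans hX'
          rw [if_pos rfl]
          exact ⟨hH, by rw [hU]; exact Set.subset_union_right⟩
        · rw [if_neg hh, hX']
          refine ⟨handles_singleton, ?_⟩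
          rintro ⟨n, w⟩ hw
          obtain ⟨rfl, hw'⟩ := mem_worldsOf_singleton.1 hw
          rw [hU]
          exact .inl ⟨X', by rwa [Finmap.lookup_erase_ne hh], hw'⟩) (fun o ho => by
        rw [hU] at ho
        rcases ho with ⟨X', hX', ho⟩ | ho
        · by_cases hh : o.1 = h
          · rw [hh, Finmap.lookup_erase] at hX'
            cases hX'
          · simp only [Finmap.lookup_erase_ne hh] at hX'
            refine ⟨o.1, X', hX', ?_⟩
            rw [if_neg hh, hX']
            exact mem_worldsOf_singleton.2 ⟨rfl, ho⟩
        · exact ⟨h, X, hX, by rwa [if_pos rfl]⟩)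
    obtain ⟨h₃, h₄⟩ := S.semMerge_sound hS hs.extends.1 h₁
    exact h₂ (h₄ (ih S h₃))

theorem MergeF.typed {Δ F₁ F₂ F} (h : MergeF F₁ F₂ F) (h₁ : FillingTyped Sg Δ F₁)
    (h₂ : FillingTyped Sg Δ F₂) : FillingTyped Sg Δ F := fun n e he =>
  (h.lookup he).elim (h₁ n e) (h₂ n e)

theorem MergeList.typed {Δ Ks K} (h : MergeList Ks K)
    (hK : ∀ K' ∈ Ks, FillingTyped Sg Δ K'.F) : FillingTyped Sg Δ K.F := fun n e he =>
  let ⟨K', h₁, h₂⟩ := h.lookup he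
  hK K' h₁ n e h₂

theorem fillingTyped_empty {Δ} : FillingTyped Sg Δ ∅ := fun n e he => by simp at he

theorem fillingTyped_singleton {Δ Γ e T} {h : Hole} (hΔ : Δ.lookup h = some (Γ, T))
    (ht : HasType Sg Δ Γ e T) : FillingTyped Sg Δ (Finmap.singleton h e) := by
  intro n e' he
  by_cases hn : n = h
  · subst hn
    rw [Finmap.lookup_singleton_eq] at he
    cases he
    exact ⟨Γ, T, hΔ, ht⟩
  · rw [Finmap.lookup_eq_none.2 (by rwa [Finmap.mem_singleton])] at he
    cases he

/-- Guessed fillings are well typed. -/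
def GuessesTyped (Gs : GuessFn) (Sg : DataCtx) : Prop :=
  ∀ (Δ : HoleCtx) (r : Result), ∀ F_g ∈ Gs Δ Sg r, FillingTyped Sg Δ F_g

theorem Uneval.typed (hGs : GuessesTyped Gs Sg) {Δ F r ex K}
    (h : Uneval Gs Sg Δ F r ex K) : FillingTyped Sg Δ K.F := by
  induction h with
  | top => exact fillingTyped_empty
  | unit => exact fillingTyped_empty
  | pair _ _ hM ih₁ ih₂ => exact hM.1.typed ih₁ ih₂
  | ctor _ ih => exact ih
  | fix _ _ ih => exact ih
  | hole => exact fillingTyped_empty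
  | app _ _ ih => exact ih
  | prjFst _ ih => exact ih
  | prjSnd _ ih => exact ih
  | caseOf _ _ _ _ hM ih₁ ih₂ => exact hM.1.typed ih₁ ih₂
  | unwrap _ ih => exact ih
  | caseGuess _ hg _ _ _ _ hM ih => exact hM.1.typed (hGs _ _ _ hg) ih

theorem LiveCheck.typed (hGs : GuessesTyped Gs Sg) {Δ F e X K}
    (h : LiveCheck Gs Sg Δ F e X K) : FillingTyped Sg Δ K.F := by
  obtain ⟨ws, -, hws, hM⟩ := h
  refine hM.typed fun K' hK' => ?_
  obtain ⟨p, hp, rfl⟩ := List.mem_map.1 hK'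
  obtain ⟨r, -, hu⟩ := hws p hp
  exact hu.typed hGs

theorem Step.typed (hGs : GuessesTyped Gs Sg) {Δ K K'}
    (h : Step Gs Sg Δ K K') (hK : FillingTyped Sg Δ K.F) :
    FillingTyped Sg Δ K'.F := by
  obtain ⟨ks, K'', -, hdom, hres, hL, hM⟩ := h
  refine hM.1.typed hK (hL.typed fun K' hK' => ?_)
  obtain ⟨p, hp, rfl⟩ := List.mem_map.1 hK'
  obtain ⟨X, hX⟩ := Finmap.mem_iff.1 ((hdom p.1).1 (List.mem_map_of_mem hp))
  have hr := hres p hp X hX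
  generalize p.2 = K₁ at hr
  cases hr with
  | filled _ hc => exact hc.typed hGs
  | unfilled => exact fillingTyped_empty

theorem SemMerge.typed (hGs : GuessesTyped Gs Sg) {Δ K K'}
    (h : SemMerge Gs Sg Δ K K') (hK : FillingTyped Sg Δ K.F) :
    FillingTyped Sg Δ K'.F := by
  induction h with
  | next h _ _ ih => exact ih (h.typed hGs hK)
  | stop_here h _ => exact h.typed hGs hK

theorem Fill.typed (hGs : GuessesTyped Gs Sg) (hSg : Sg.WellFormed) {Δ h F Γ X T K Δ₁}
    (hf : Fill Gs Sg Δ h F Γ X T K Δ₁)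
    (hh : Δ.lookup h = some (Γ, T)) : FillingTyped Sg (Δ ∪ Δ₁) K.F := by
  have hh' := extendsCtx_union Δ Δ₁ _ _ hh
  cases hf with
  | guessAndCheck hguess hc hM =>
    exact hM.1.typed (fillingTyped_singleton hh' hguess.hasType)
      ((hc.typed hGs).weaken (extendsCtx_union _ _))
  | defer => exact fillingTyped_singleton hh' (.hole hh')
  | refine hr =>
    obtain ⟨h₁, h₂⟩ := hr.fresh
    have hG := fun g hg => goalsCtx_lookup_union (g := g) h₁ h₂ hg
    refine fillingTyped_singleton hh' ?_
    cases hr with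
    | unit => exact .unit
    | pair => exact .pair (.hole (hG _ (.head _))) (.hole (hG _ (.tail _ (.head _))))
    | ctor _ _ hC _ => exact .ctor hC (.hole (hG _ (.head _)))
    | fix => exact .fix (.hole (hG _ (.head _)))
  | branch hb hM =>
    obtain ⟨h₁, h₂⟩ := hb.fresh
    have hG := fun g hg => goalsCtx_lookup_union (g := g) h₁ h₂ hg
    cases hb with
    | @mk D cs e K J as hD hguess hX hJ has hf hnd hL =>
      refine hM.1.typed (fillingTyped_singleton hh' ?_) (hL.typed fun K' hK' => ?_)
      · refine .caseOf hguess.hasType hD (by rw [← has]; simp) fun C T' x e' hC hm => ?_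
        obtain ⟨a, ha, hae⟩ := List.mem_map.1 hm
        cases hae
        have haT : (a.C, a.T) ∈ cs := by
          rw [← has]
          exact List.mem_map_of_mem (f := fun a : Arm => (a.C, a.T)) ha
        obtain rfl := hSg.mem_unique hD hC haT
        exact .hole (hG _ (List.mem_map_of_mem
          (f := fun a : Arm => (⟨a.h, (a.x, a.T) :: Γ, T, a.worlds J⟩ : Goal)) ha))
      · obtain ⟨j, hj, rfl⟩ := List.mem_map.1 hK'
        exact ((hJ j hj).2.2.typed hGs).weaken (extendsCtx_union _ _)

theorem Solve.typed (hGs : GuessesTyped Gs Sg) (hSg : Sg.WellFormed) {Δ K F Δ'}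
    (h : Solve Gs Sg Δ K F Δ')
    (hK : FillingTyped Sg Δ K.F) : FillingTyped Sg Δ' F := by
  induction h with
  | done => exact hK
  | one _ hΔ hf hM hS _ ih =>
    exact ih (hS.typed hGs (hM.1.typed (hK.weaken (extendsCtx_union _ _)) (hf.typed hGs hSg hΔ)))

end

end Smyth

end

theorem mainTheorem5 (Sg : Smyth.DataCtx) (hSg : Smyth.DataCtx.WellFormed Sg)
    (Gs : Smyth.GuessFn)
    (hGs : ∀ (Δ : Smyth.HoleCtx) (r : Smyth.Result), ∀ F_g ∈ Gs Δ Sg r,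
      Smyth.FillingTyped Sg Δ F_g)
    (Δ Δ' : Smyth.HoleCtx) (U : Smyth.Unfilled) (F F' : Smyth.Filling)
    (hU : Smyth.UnfilledTyped Sg Δ U) (hF : Smyth.FillingTyped Sg Δ F)
    (hSolve : Smyth.Solve Gs Sg Δ ⟨F, U⟩ F' Δ') :
    Smyth.FillingTyped Sg Δ' F' ∧
      (Smyth.Total Sg Δ' F' U → Smyth.ConstraintSat F' ⟨F, U⟩) := by
  have hF' := hSolve.typed hGs hSg hF
  refine ⟨hF', ?_⟩
  rintro ⟨P, hsub, hcode, hUcode, heval, hres⟩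
  have S : Smyth.TotalOn Sg Δ' F' P :=
    ⟨hSg, hF', hsub _ _, hcode _ _, heval _ _ _ _, hres _ _⟩
  refine ⟨hSolve.extends.1, fun h X hX w hw => ?_⟩
  have hsat := Smyth.TotalOn.solve_sound hSolve S (fun A hA o ho => hA o ho fun _ => by
    obtain ⟨X, hX, hw⟩ := ho
    obtain ⟨Γ, T, hΔ, ht⟩ := hU _ _ hX
    obtain ⟨hE, hx⟩ := ht _ hw
    exact ⟨Γ, T, hSolve.extends.2 _ _ hΔ,
      hE.good hSolve.extends.2 (hUcode _ _ hX _ hw), hx.good hSolve.extends.2⟩)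
  obtain ⟨s, hs, hx⟩ := hsat (h, w) ⟨X, hX, hw⟩
  exact ⟨s, ⟨_, .hole, hs⟩, hx⟩
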